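/- **Setting.** A noisy parameterized dynamic circuit on $n$ qubits with parameters $\theta\in\mathbb R^p$, $\theta\sim\mathcal D_p$, is a sequence of operations arranged in time steps, applied to $|0^n\rangle\langle 0^n|$. Each operation is one of: (a) a one-qubit unitary gate $U(\theta)$; (b) a feedforward operation on one qubit: measure it in the computational basis, apply $$U_1=\begin{pmatrix}\cos\varphi\, e^{-i\phi}&-i\sin\varphi\\-i\sin\varphi&\cos\varphi\, e^{i\phi}\end{pmatrix}$$ if the outcome is $1$, and forget the outcome; (c) a two-qubit unitary gate $U(\theta)$ on two qubits joined by an edge of the architecture graph, followed by one-qubit noise channels, one on each of these two qubits. In each time step the two-qubit gates act on disjoint pairs. Let $\rho(\theta)$ be the output state. For one qubit let $\mathtt I=I/4$ and $\mathtt S=S/2$ on two copies, where $S$ is the swap of the copies. A (random) operation has transfer matrix $T$ if applying two copies of it and then averaging over independent Haar random one-qubit gates on its qubits (each applied to both copies) maps each basis element ($\mathtt I,\mathtt S$ for one qubit; $\mathtt{II},\mathtt{IS},\mathtt{SI},\mathtt{SS}$ for two) to the combination of basis elements given by the corresponding column of $T$. **Assumptions.** 1. Every component of $\theta$ parameterizes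 only a single operation, gates depend measurably on $\theta$, and the parameter blocks of distinct operations are independent under $\mathcal D_p$. 2. The circuit is locally scrambling: there is a one-qubit unitary 2-design such that the distribution of the circuit channel is unchanged when independent random gates from the 2-design are inserted on every qubit after its initialization and, after every operation (gate, feedforward operation, noise channel), on the qubits on which it acts. 3. Every random two-qubit gate has a transfer matrix $$\begin{pmatrix}1&\frac{4\alpha}5&\frac{4\alpha}5&0\\0&1-\alpha-\beta&\beta&0\\0&\beta&1-\alpha-\beta&0\\0&\frac\alpha5&\frac\alpha5&1\end{pmatrix},$$ with a common $\alpha\in[0,1]$ and some $\beta\in[0,1-\alpha]$, which may depend on the gate. 4. The worst-case feedforward distance is $f<\infty$: it is the maximum over qubits $j$ of the minimum, over all paths through the circuit that start at a feedforward operation and end on qubit $j$ at the end of the circuit, of the number of two-qubit gates that the path traverses. (A path may move from one qubit to another only through an operation acting on both.) 5. Every noise channel is completely positive and trace preserving and has transfer matrix $\begin{pmatrix}1-\delta&\gamma\\\delta&1-\gamma\end{pmatrix}$, with nonunitarity $\gamma$ and nonunitality $\delta$ satisfying $0\le\delta\le\gamma\le\frac12$. **Theorem.** Let $H=\sum_{\boldsymbol\alpha}c_{\boldsymbol\alpha}\boldsymbol\alpha$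 be a $k$-local Hermitian observable expanded in $n$-qubit Pauli words $\boldsymbol\alpha$ with real coefficients, where $k$-local means a sum of Hermitian terms each acting on at most $k$ qubits, and let $|\boldsymbol\alpha|$ be the number of qubits in the support of $\boldsymbol\alpha$. Then the loss $L(\theta)=\operatorname{Tr}\rho(\theta)H$ satisfies $$\operatorname{Var}_{\theta\sim\mathcal D_p}L\ \ge\ \sum_{\boldsymbol\alpha\neq I}c_{\boldsymbol\alpha}^2\left(\frac{\sin^2\varphi}{3}\right)^{|\boldsymbol\alpha|}\left(\frac\alpha5(1-\gamma-\delta)+\delta\right)^{kf}.$$ -/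

import Mathlib

open MeasureTheory ProbabilityTheory
open scoped Kronecker Matrix

noncomputable section

namespace DynQC

/-! ### The one-qubit unitary group, Haar measure and 2-designs -/

/-- One-qubit unitaries. -/
abbrev U2 : Type := Matrix.unitaryGroup (Fin 2) ℂ

/-- Two-qubit unitaries; the basis of the two qubits is `Fin 2 × Fin 2`. -/
abbrev U4 : Type := Matrix.unitaryGroup (Fin 2 × Fin 2) ℂ

instance : MeasurableSpace U2 := borel U2

instance : BorelSpace U2 := ⟨rfl⟩

instance : CompactSpace U2 := by
  have hc : IsCompact {A : Fin 2 → Fin 2 → ℂ | ∀ i, A i ∈ {v : Fin 2 → ℂ |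
      ∀ j, v j ∈ Metric.closedBall (0 : ℂ) 1}} :=
    isCompact_pi_infinite fun _ => isCompact_pi_infinite fun _ => isCompact_closedBall _ _
  have hcl : IsClosed {A : Matrix (Fin 2) (Fin 2) ℂ | A * star A = 1} :=
    isClosed_eq (continuous_id.mul continuous_star) continuous_const
  apply isCompact_iff_compactSpace.mp
  refine IsCompact.of_isClosed_subset hc ?_ ?_
  · have h : ((Matrix.unitaryGroup (Fin 2) ℂ : Submonoid (Matrix (Fin 2) (Fin 2) ℂ)) :
        Set (Matrix (Fin 2) (Fin 2) ℂ)) = {A | A * star A = 1} := by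
      ext A
      exact Matrix.mem_unitaryGroup_iff
    rw [h]
    exact hcl
  · intro A hA i j
    simpa using entry_norm_bound_of_unitary hA i j

/-- The Haar probability measure on one-qubit unitaries. -/
def haarU2 : Measure U2 := Measure.haarMeasure ⊤

/-- The average `𝔼_V [V⊗V O V†⊗V†]` over `V ∼ μ` of a two-copy operator of one qubit. -/
def twirl (μ : Measure U2) (O : Matrix (Fin 2 × Fin 2) (Fin 2 × Fin 2) ℂ) :
    Matrix (Fin 2 × Fin 2) (Fin 2 × Fin 2) ℂ :=
  Matrix.of fun a b => ∫ V, (((V : Matrix (Fin 2) (Fin 2) ℂ) ⊗ₖ (V : Matrix (Fin 2) (Fin 2) ℂ)) *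
    O * ((V : Matrix (Fin 2) (Fin 2) ℂ) ⊗ₖ (V : Matrix (Fin 2) (Fin 2) ℂ))ᴴ) a b ∂μ

/-- `μ` is a one-qubit unitary 2-design. -/
def IsTwoDesign (μ : Measure U2) : Prop :=
  IsProbabilityMeasure μ ∧ ∀ O, twirl μ O = twirl haarU2 O

/-! ### Operators on `n` qubits -/

/-- Computational basis labels of `n` qubits. -/
abbrev Bits (n : ℕ) : Type := Fin n → Fin 2

/-- Linear operators on `n` qubits. -/
abbrev Oper (n : ℕ) : Type := Matrix (Bits n) (Bits n) ℂ

variable {n p d m : ℕ}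

/-- The tensor product `⨂ i, A i` of one-qubit operators. -/
def tensor (A : Fin n → Matrix (Fin 2) (Fin 2) ℂ) : Oper n :=
  Matrix.of fun x y => ∏ i, A i (x i) (y i)

/-- The one-qubit operator `A` acting on qubit `j`. -/
def embed1 (j : Fin n) (A : Matrix (Fin 2) (Fin 2) ℂ) : Oper n :=
  tensor fun i => if i = j then A else 1

/-- The two-qubit operator `A` acting on the qubits `i` (first factor) and `j` (second factor),
for `i ≠ j`. -/
def embed2 (i j : Fin n) (A : Matrix (Fin 2 × Fin 2) (Fin 2 × Fin 2) ℂ) : Oper n :=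
  Matrix.of fun x y => if ∀ l, l ≠ i → l ≠ j → x l = y l then A (x i, x j) (y i, y j) else 0

/-- The unitary gates `V i` applied to the qubits `i ∈ S`. -/
def gatesOn (S : Finset (Fin n)) (V : Fin n → U2) : Oper n :=
  tensor fun i => if i ∈ S then (V i : Matrix (Fin 2) (Fin 2) ℂ) else 1

/-- The map `ρ ↦ A ρ A†`. -/
def conj {ι : Type*} [Fintype ι] (A ρ : Matrix ι ι ℂ) : Matrix ι ι ℂ := A * ρ * Aᴴ

theorem tensor_one : tensor (fun _ : Fin n => (1 : Matrix (Fin 2) (Fin 2) ℂ)) = 1 := by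
  ext x y
  by_cases h : x = y
  · subst h
    simp [tensor]
  · obtain ⟨i, hi⟩ := Function.ne_iff.mp h
    rw [Matrix.one_apply_ne h]
    exact Finset.prod_eq_zero (Finset.mem_univ i) (Matrix.one_apply_ne hi)

/-- Applying identity gates changes nothing. -/
theorem conj_gatesOn_one (S : Finset (Fin n)) (ρ : Oper n) :
    conj (gatesOn S fun _ => 1) ρ = ρ := by
  have h : gatesOn S (fun _ => (1 : U2)) = 1 := by
    rw [← tensor_one]
    simp [gatesOn]
  rw [h, conj]
  simp

/-! ### Pauli words and local observables -/

/-- The one-qubit Pauli matrices `I, X, Y, Z`. -/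
def pauli : Fin 4 → Matrix (Fin 2) (Fin 2) ℂ :=
  ![1, !![0, 1; 1, 0], !![0, -Complex.I; Complex.I, 0], !![1, 0; 0, -1]]

/-- The Pauli word `⨂ i, pauli (a i)`. -/
def pauliWord (a : Fin n → Fin 4) : Oper n := tensor fun i => pauli (a i)

/-- The weight of a Pauli word: the number of qubits in its support. -/
def weight (a : Fin n → Fin 4) : ℕ := (Finset.univ.filter fun i => a i ≠ 0).card

/-- `M` has the form `M' ⊗ I` with `M'` acting on the qubits in `A`. -/
def ActsOn (A : Finset (Fin n)) (M : Oper n) : Prop :=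
  ∃ M' : Matrix (A → Fin 2) (A → Fin 2) ℂ, ∀ x y,
    M x y = if ∀ i, i ∉ A → x i = y i then M' (fun i => x i) (fun i => y i) else 0

/-- A `k`-local observable: a sum of Hermitian terms, each acting on at most `k` qubits. -/
def IsKLocal (k : ℕ) (H : Oper n) : Prop :=
  ∃ (r : ℕ) (h : Fin r → Oper n),
    (∀ l, (h l).IsHermitian ∧ ∃ A : Finset (Fin n), A.card ≤ k ∧ ActsOn A (h l)) ∧
    H = ∑ l, h l

/-! ### One-qubit noise channels and feedforward operations -/

/-- A one-qubit channel (completely positive trace-preserving map), in Kraus form. -/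
structure QubitChannel where
  rank : ℕ
  kraus : Fin rank → Matrix (Fin 2) (Fin 2) ℂ
  sum_kraus : ∑ l, (kraus l)ᴴ * kraus l = 1

/-- The channel acting on qubit `j` of `n` qubits. -/
def QubitChannel.applyAt (N : QubitChannel) (j : Fin n) (ρ : Oper n) : Oper n :=
  ∑ l, conj (embed1 j (N.kraus l)) ρ

/-- The map `N ⊗ N` on two-copy operators of one qubit. -/
def QubitChannel.twoCopy (N : QubitChannel) (X : Matrix (Fin 2 × Fin 2) (Fin 2 × Fin 2) ℂ) :
    Matrix (Fin 2 × Fin 2) (Fin 2 × Fin 2) ℂ :=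
  ∑ l, ∑ l', conj (N.kraus l ⊗ₖ N.kraus l') X

/-- The gate `U₁` of the feedforward operation. -/
def ffGate (φ ϕ : ℝ) : Matrix (Fin 2) (Fin 2) ℂ :=
  !![Real.cos φ * Complex.exp (-(Complex.I * ϕ)), -(Complex.I * Real.sin φ);
     -(Complex.I * Real.sin φ), Real.cos φ * Complex.exp (Complex.I * ϕ)]

/-- The feedforward operation on qubit `j`: measure `j` in the computational basis, apply `U₁` to
it if the result is `1`, and forget the result. -/
def feedforwardAt (φ ϕ : ℝ) (j : Fin n) (ρ : Oper n) : Oper n :=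
  conj (embed1 j !![1, 0; 0, 0]) ρ + conj (embed1 j (ffGate φ ϕ * !![0, 0; 0, 1])) ρ

/-! ### Transfer matrices -/

/-- The two-copy operators of one qubit: the trace-one identity (label `0`) and the trace-one
SWAP (label `1`). -/
def site : Fin 2 → Matrix (Fin 2 × Fin 2) (Fin 2 × Fin 2) ℂ :=
  ![(1 / 4 : ℂ) • 1,
    (1 / 2 : ℂ) • Matrix.of fun a b => if a.1 = b.2 ∧ a.2 = b.1 then 1 else 0]

/-- The two-copy operator `site x ⊗ site y` of a pair of qubits. The index is
`(first copy of the pair, second copy of the pair)`. -/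
def pairSite (x y : Fin 2) :
    Matrix ((Fin 2 × Fin 2) × (Fin 2 × Fin 2)) ((Fin 2 × Fin 2) × (Fin 2 × Fin 2)) ℂ :=
  Matrix.of fun a b =>
    site x (a.1.1, a.2.1) (b.1.1, b.2.1) * site y (a.1.2, a.2.2) (b.1.2, b.2.2)

/-- The basis `II, IS, SI, SS` of two-copy average states of a pair of qubits. -/
def pairBasis : Fin 4 →
    Matrix ((Fin 2 × Fin 2) × (Fin 2 × Fin 2)) ((Fin 2 × Fin 2) × (Fin 2 × Fin 2)) ℂ :=
  ![pairSite 0 0, pairSite 0 1, pairSite 1 0, pairSite 1 1]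

/-- The transfer matrix of a two-qubit gate ensemble. -/
def gateTransfer (α β : ℝ) : Matrix (Fin 4) (Fin 4) ℝ :=
  !![1, 4 * α / 5, 4 * α / 5, 0;
     0, 1 - α - β, β, 0;
     0, β, 1 - α - β, 0;
     0, α / 5, α / 5, 1]

/-- The transfer matrix of a one-qubit noise channel with nonunitarity `γ` and
nonunitality `δ`. -/
def noiseTransfer (γ δ : ℝ) : Matrix (Fin 2) (Fin 2) ℝ :=
  !![1 - δ, γ; δ, 1 - γ]

/-- The two-qubit gate `(V₁ ⊗ V₂) U`. -/
def dressed (V : U2 × U2) (U : U4) : Matrix (Fin 2 × Fin 2) (Fin 2 × Fin 2) ℂ :=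
  ((V.1 : Matrix (Fin 2) (Fin 2) ℂ) ⊗ₖ (V.2 : Matrix (Fin 2) (Fin 2) ℂ)) *
    (U : Matrix (Fin 2 × Fin 2) (Fin 2 × Fin 2) ℂ)

/-- `𝔼 [(V₁V₂ ⊗ V₁V₂) (U ⊗ U) X (U ⊗ U)† (V₁V₂ ⊗ V₁V₂)†]` for `U = U(θ)` with `θ ∼ D`, and
`V₁`, `V₂` independent Haar random one-qubit gates. -/
def gateAverage (D : Measure (Fin p → ℝ)) (U : (Fin p → ℝ) → U4)
    (X : Matrix ((Fin 2 × Fin 2) × (Fin 2 × Fin 2)) ((Fin 2 × Fin 2) × (Fin 2 × Fin 2)) ℂ) :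
    Matrix ((Fin 2 × Fin 2) × (Fin 2 × Fin 2)) ((Fin 2 × Fin 2) × (Fin 2 × Fin 2)) ℂ :=
  Matrix.of fun a b => ∫ θ, ∫ V, conj (dressed V (U θ) ⊗ₖ dressed V (U θ)) X a b
    ∂(haarU2.prod haarU2) ∂D

/-- The random two-qubit gate `U(θ)`, `θ ∼ D`, has transfer matrix `gateTransfer α β`. -/
def HasGateTransfer (D : Measure (Fin p → ℝ)) (U : (Fin p → ℝ) → U4) (α β : ℝ) : Prop :=
  ∀ x, gateAverage D U (pairBasis x) = ∑ y, (gateTransfer α β y x : ℂ) • pairBasis y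

/-- The noise channel has transfer matrix `noiseTransfer γ δ`. -/
def QubitChannel.HasTransfer (N : QubitChannel) (γ δ : ℝ) : Prop :=
  ∀ x, twirl haarU2 (N.twoCopy (site x)) = ∑ y, (noiseTransfer γ δ y x : ℂ) • site y

/-! ### Noisy parameterized dynamic circuits -/

/-- The operations of a noisy parameterized dynamic circuit on `n` qubits with `p` real
parameters: a one-qubit gate; a feedforward operation; a two-qubit gate on `i` and `j` which is
followed by the noise channel `Ni` on `i` and the noise channel `Nj` on `j`. -/
inductive Op (n p : ℕ) : Type
  | gate1 (j : Fin n) (U : (Fin p → ℝ) → U2) : Op n p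
  | feedforward (j : Fin n) : Op n p
  | gate2 (i j : Fin n) (U : (Fin p → ℝ) → U4) (Ni Nj : QubitChannel) : Op n p

namespace Op

/-- The qubits on which an operation acts. -/
def supp : Op n p → Finset (Fin n)
  | gate1 j _ => {j}
  | feedforward j => {j}
  | gate2 i j _ _ _ => {i, j}

/-- The operation is a two-qubit operation. -/
def IsTwoQubit : Op n p → Prop
  | gate2 _ _ _ _ _ => True
  | _ => False

/-- The gate of the operation is a measurable function of the parameters. -/
def GateMeasurable : Op n p → Prop
  | gate1 _ U => ∀ a b, Measurable fun θ => (U θ : Matrix (Fin 2) (Fin 2) ℂ) a b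
  | feedforward _ => True
  | gate2 _ _ U _ _ => ∀ a b, Measurable fun θ =>
      (U θ : Matrix (Fin 2 × Fin 2) (Fin 2 × Fin 2) ℂ) a b

/-- The operation depends only on the components `i ∈ S` of the parameter vector. -/
def DependsOnlyOn (S : Set (Fin p)) : Op n p → Prop
  | gate1 _ U => ∀ θ θ' : Fin p → ℝ, (∀ i ∈ S, θ i = θ' i) → U θ = U θ'
  | feedforward _ => True
  | gate2 _ _ U _ _ => ∀ θ θ' : Fin p → ℝ, (∀ i ∈ S, θ i = θ' i) → U θ = U θ'

/-- If the operation is a two-qubit operation, its gate has a transfer matrix with parameters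
`α ∈ [0, 1]` and some `β ∈ [0, 1 - α]`. -/
def GateTransferCondition (D : Measure (Fin p → ℝ)) (α : ℝ) : Op n p → Prop
  | gate2 _ _ U _ _ => ∃ β, 0 ≤ β ∧ β ≤ 1 - α ∧ HasGateTransfer D U α β
  | _ => True

/-- If the operation is a two-qubit operation, its noise channels have nonunitarity `γ` and
nonunitality `δ`. -/
def NoiseTransferCondition (γ δ : ℝ) : Op n p → Prop
  | gate2 _ _ _ Ni Nj => Ni.HasTransfer γ δ ∧ Nj.HasTransfer γ δ
  | _ => True

/-- The action of an operation at parameters `θ`, with extra one-qubit gates inserted on its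
support: `V` after the gate or feedforward operation, and `V'` after the noise. -/
def runInserted (φ ϕ : ℝ) (θ : Fin p → ℝ) (V V' : Fin n → U2) : Op n p → Oper n → Oper n
  | gate1 j U, ρ => conj (gatesOn {j} V) (conj (embed1 j (U θ : Matrix (Fin 2) (Fin 2) ℂ)) ρ)
  | feedforward j, ρ => conj (gatesOn {j} V) (feedforwardAt φ ϕ j ρ)
  | gate2 i j U Ni Nj, ρ =>
      conj (gatesOn {i, j} V') (Nj.applyAt j (Ni.applyAt i
        (conj (gatesOn {i, j} V)
          (conj (embed2 i j (U θ : Matrix (Fin 2 × Fin 2) (Fin 2 × Fin 2) ℂ)) ρ))))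

end Op

/-- A noisy parameterized dynamic circuit of depth `d` with `m` operations, listed in the order in
which they are applied; `time s` is the time step to which operation `s` belongs. In each time step
the two-qubit operations act on disjoint pairs of qubits, along edges of the architecture graph. -/
structure Circuit (n p d m : ℕ) where
  graph : SimpleGraph (Fin n)
  op : Fin m → Op n p
  time : Fin m → Fin d
  time_mono : Monotone time
  adj : ∀ s i j U Ni Nj, op s = Op.gate2 i j U Ni Nj → graph.Adj i j
  nonoverlapping : ∀ s t, s ≠ t → time s = time t → (op s).IsTwoQubit → (op t).IsTwoQubit →
    Disjoint (op s).supp (op t).supp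

/-- The places where one-qubit gates can be inserted: on every qubit after its initialization
(`inl`), and on qubit `j` after operation `s` (`inr (s, false, j)`), respectively after the noise
that follows operation `s` (`inr (s, true, j)`). -/
abbrev Place (n m : ℕ) : Type := Fin n ⊕ (Fin m × Bool × Fin n)

namespace Circuit

/-- The channel of the circuit at parameters `θ` with the one-qubit gates `V` inserted. -/
def channelInserted (C : Circuit n p d m) (φ ϕ : ℝ) (θ : Fin p → ℝ) (V : Place n m → U2)
    (ρ : Oper n) : Oper n :=
  Fin.foldl m
    (fun σ s => (C.op s).runInserted φ ϕ θ
      (fun j => V (Sum.inr (s, false, j))) (fun j => V (Sum.inr (s, true, j))) σ)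
    (conj (gatesOn Finset.univ fun j => V (Sum.inl j)) ρ)

/-- The channel of the circuit at parameters `θ` (inserted identity gates do nothing). -/
def channel (C : Circuit n p d m) (φ ϕ : ℝ) (θ : Fin p → ℝ) (ρ : Oper n) : Oper n :=
  C.channelInserted φ ϕ θ (fun _ => 1) ρ

/-- The output state on input `|0ⁿ⟩⟨0ⁿ|`. -/
def output (C : Circuit n p d m) (φ ϕ : ℝ) (θ : Fin p → ℝ) : Oper n :=
  C.channel φ ϕ θ (Matrix.single 0 0 1)

/-- The loss function `L(θ) = Tr ρ(θ) H`. -/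
def loss (C : Circuit n p d m) (φ ϕ : ℝ) (H : Oper n) (θ : Fin p → ℝ) : ℝ :=
  (C.output φ ϕ θ * H).trace.re

/-- All gates are measurable functions of the parameters. -/
def GatesMeasurable (C : Circuit n p d m) : Prop := ∀ s, (C.op s).GateMeasurable

/-- Every component of `θ` parameterizes a single operation (its `owner`), and under `D` the
operations are drawn independently: the parameter blocks of distinct operations are independent. -/
def SeparatelyParameterized (C : Circuit n p d m) (D : Measure (Fin p → ℝ)) : Prop :=
  ∃ owner : Fin p → Fin m,
    (∀ s, (C.op s).DependsOnlyOn {i | owner i = s}) ∧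
    iIndepFun (fun (s : Fin m) (θ : Fin p → ℝ) (i : {i // owner i = s}) => θ i) D

/-- The ensemble `C(θ)`, `θ ∼ D`, is locally scrambling: for some one-qubit unitary 2-design `E`,
the distribution of the channel does not change when independent gates drawn from `E` are inserted
at all places. A channel is given by its values on the matrix units. -/
def LocallyScrambling (C : Circuit n p d m) (φ ϕ : ℝ) (D : Measure (Fin p → ℝ)) : Prop :=
  ∃ E : Measure U2, IsTwoDesign E ∧
    Measure.map (fun (θ : Fin p → ℝ) (x y z w : Bits n) =>
        C.channel φ ϕ θ (Matrix.single x y 1) z w) D =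
    Measure.map (fun (ω : (Fin p → ℝ) × (Place n m → U2)) (x y z w : Bits n) =>
        C.channelInserted φ ϕ ω.1 ω.2 (Matrix.single x y 1) z w)
      (D.prod (Measure.pi fun _ => E))

/-- A path from a feedforward operation to qubit `j` at the end of the circuit. `loc s.castSucc`
and `loc s.succ` are the positions just before and just after operation `s`; the positions before
the completion of the operation `start` are irrelevant. The position changes only within
the support of an operation. -/
structure FeedforwardPath (C : Circuit n p d m) (j : Fin n) where
  start : Fin m
  loc : Fin (m + 1) → Fin n
  start_feedforward : C.op start = Op.feedforward (loc start.succ)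
  connected : ∀ s, start < s → loc s.castSucc = loc s.succ ∨
    (loc s.castSucc ∈ (C.op s).supp ∧ loc s.succ ∈ (C.op s).supp)
  ends : loc (Fin.last m) = j

open Classical in
/-- The length of a path: the number of two-qubit operations that it traverses. -/
def FeedforwardPath.length {C : Circuit n p d m} {j : Fin n} (P : C.FeedforwardPath j) : ℕ :=
  (Finset.univ.filter fun s => P.start < s ∧ (C.op s).IsTwoQubit ∧
    P.loc s.castSucc ∈ (C.op s).supp ∧ P.loc s.succ ∈ (C.op s).supp).card

/-- The feedforward distance of qubit `j` (infinite if there is no path). -/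
def feedforwardDistance (C : Circuit n p d m) (j : Fin n) : ℕ∞ :=
  ⨅ P : C.FeedforwardPath j, (P.length : ℕ∞)

/-- The worst-case feedforward distance. -/
def worstFeedforwardDistance (C : Circuit n p d m) : ℕ∞ := ⨆ j, C.feedforwardDistance j

end Circuit

end DynQC

end

noncomputable section

namespace DynQC

variable {n p d m : ℕ}

/-! ### Regions of the qubit register -/

/-! By local scrambling, the circuit may be replaced by one with independent 2-design gates inserted
at all places, since the law of the channel is the same. For that circuit the second moment `𝔼[ρ ⊗
ρ]` after each operation is a combination `∑ v, w v • siteWord v` of products of the one-qubit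
operators `I/4` and `S/2`, and each operation acts on the weights `w` through its transfer matrix
(`HasMoments.apply`); this uses that its parameters and inserted gates are independent of the past.
All transfer matrices are entrywise nonnegative, so `w` can be read as a distribution of random
labels in {I, S}, one per qubit.

Paired with two Pauli matrices, a site gives 0 if they differ, 1 if both are the identity, and
otherwise the indicator of the label S (`site_pauli`). Hence distinct Pauli words have uncorrelated
expectation values, and the second moment for the word `a` is `tail w (pauliSupp a)`, the weight of
the configurations with label S on the whole support. The identity word contributes exactly the
mean, because the state has trace one. So the variance is at least `∑ c a ^ 2 * tail w (pauliSupp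
a)` over `a ≠ 0` (`sum_tail_le_variance`).

It remains to bound the tails below. Put `σ = sin²φ / 3` and `q = α/5 (1-γ-δ) + δ`. A feedforward
operation produces the label S with weight at least `σ`, whatever the label was before. If at least
one label S enters a noisy two-qubit gate, then a given output qubit carries S with weight at least
`q`, and both do with weight at least `q²` (`pairAdjoint_left`, `pairAdjoint_right`,
`pairAdjoint_both`). Thus the invariant `TailBound` survives every operation: if each qubit `i` of
`A` is reached from a feedforward operation through `L i` two-qubit gates, then `tail w A ≥ σ^|A|
q^(∑ L i)`. Where two paths meet at a gate, only one is followed further back; the factors of the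
other are at most 1. In the end every qubit is reached at distance at most `f`, and words of weight
above `k` have coefficient zero, which gives the exponent `k f`. -/

/-- The tensor product of the one-qubit two-copy operators `site (v i)`; the entry at first-copy
indices `x, y` and second-copy indices `x', y'`. -/
def siteWord (v x x' y y' : Bits n) : ℂ := ∏ i, site (v i) (x i, x' i) (y i, y' i)

/-- A region of the register, with basis labels `κ`: the labels of the region can be read off and
overwritten, and the products `siteWord` factor into a part on the region and a remaining part. -/
structure Region (n : ℕ) (κ : Type) [Fintype κ] [DecidableEq κ] where
  get : Bits n → κ
  set : κ → Bits n → Bits n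
  get_set : ∀ c x, get (set c x) = c
  set_get : ∀ x, set (get x) x = x
  set_set : ∀ c c' x, set c (set c' x) = set c x
  localSite : κ → Matrix (κ × κ) (κ × κ) ℂ
  rest : Bits n → Bits n → Bits n → Bits n → Bits n → ℂ
  factor : ∀ e a a' b b' v x x' y y',
    siteWord (set e v) (set a x) (set a' x') (set b y) (set b' y') =
      localSite e (a, a') (b, b') * rest v x x' y y'

/-- The region of the single qubit `j`. -/
def region1 (j : Fin n) : Region n (Fin 2) where
  get x := x j
  set c x := Function.update x j c
  get_set := by simp
  set_get := by simp
  set_set := by simp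
  localSite := site
  rest v x x' y y' := ∏ i ∈ Finset.univ.erase j, site (v i) (x i, x' i) (y i, y' i)
  factor e a a' b b' v x x' y y' := by
    rw [siteWord, ← Finset.mul_prod_erase _ _ (Finset.mem_univ j)]
    congr 1
    · simp
    · refine Finset.prod_congr rfl fun i hi => ?_
      have h : i ≠ j := Finset.ne_of_mem_erase hi
      simp [h]

/-- The region of the two qubits `i` and `j`. -/
def region2 (i j : Fin n) (hij : i ≠ j) : Region n (Fin 2 × Fin 2) where
  get x := (x i, x j)
  set c x := Function.update (Function.update x i c.1) j c.2
  get_set := by intro c x; simp [hij]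
  set_get := by intro x; simp
  set_set := by
    intro c c' x
    ext l
    by_cases h : l = j <;> by_cases h' : l = i <;> simp_all
  localSite e := pairSite e.1 e.2
  rest v x x' y y' := ∏ l ∈ (Finset.univ.erase j).erase i, site (v l) (x l, x' l) (y l, y' l)
  factor e a a' b b' v x x' y y' := by
    rw [siteWord, ← Finset.mul_prod_erase _ _ (Finset.mem_univ j),
      ← Finset.mul_prod_erase _ _ (Finset.mem_erase.mpr ⟨hij, Finset.mem_univ i⟩), ← mul_assoc]
    congr 1
    · simp [hij, pairSite, mul_comm]
    · refine Finset.prod_congr rfl fun l hl => ?_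
      have h : l ≠ i := Finset.ne_of_mem_erase hl
      have h' : l ≠ j := Finset.ne_of_mem_erase (Finset.mem_of_mem_erase hl)
      simp [h, h']

namespace Region

variable {κ : Type} [Fintype κ] [DecidableEq κ] (R : Region n κ)

theorem set_injective (x : Bits n) : Function.Injective fun c => R.set c x := fun c c' h => by
  have := congrArg R.get h
  simpa [R.get_set] using this

/-- The exchange of the label of the region with an external one. -/
def swapEquiv : Bits n × κ ≃ Bits n × κ where
  toFun z := (R.set z.2 z.1, R.get z.1)
  invFun z := (R.set z.2 z.1, R.get z.1)
  left_inv z := by simp [R.set_set, R.set_get, R.get_set]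
  right_inv z := by simp [R.set_set, R.set_get, R.get_set]

/-- A change of variables along the involution `swapEquiv`. It is the device that moves a sum over
region labels from a weight or an operator to whatever that is paired with. -/
theorem sum_swap {M : Type*} [AddCommMonoid M] (g : Bits n → κ → M) :
    ∑ x, ∑ c, g x c = ∑ x, ∑ c, g (R.set c x) (R.get x) := by
  rw [← Fintype.sum_prod_type', ← Fintype.sum_prod_type']
  exact (Equiv.sum_comp R.swapEquiv fun z => g z.1 z.2).symm

/-- `M` is the operator `A` on the region, tensored with the identity. -/
def IsLift (M : Oper n) (A : Matrix κ κ ℂ) : Prop :=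
  ∀ x y, M x y = if y = R.set (R.get y) x then A (R.get x) (R.get y) else 0

variable {R}

theorem IsLift.sum_mul {M : Oper n} {A : Matrix κ κ ℂ} (h : R.IsLift M A) (x : Bits n)
    (g : Bits n → ℂ) : ∑ z, M x z * g z = ∑ c, A (R.get x) c * g (R.set c x) := by
  have h1 : ∑ c, A (R.get x) c * g (R.set c x) =
      ∑ z ∈ Finset.univ.image (fun c => R.set c x), M x z * g z := by
    rw [Finset.sum_image fun a _ b _ hab => R.set_injective x hab]
    refine Finset.sum_congr rfl fun c _ => ?_
    rw [h, R.get_set, if_pos rfl]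
  rw [h1]
  refine (Finset.sum_subset (Finset.subset_univ _) fun z _ hz => ?_).symm
  have : z ≠ R.set (R.get z) x := fun e => hz (Finset.mem_image.mpr ⟨R.get z, by simp, e.symm⟩)
  rw [h, if_neg this, zero_mul]

theorem IsLift.mul {M N : Oper n} {A B : Matrix κ κ ℂ} (hM : R.IsLift M A) (hN : R.IsLift N B) :
    R.IsLift (M * N) (A * B) := by
  intro x y
  rw [Matrix.mul_apply, hM.sum_mul]
  by_cases hy : y = R.set (R.get y) x
  · rw [if_pos hy, Matrix.mul_apply]
    refine Finset.sum_congr rfl fun c _ => ?_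
    rw [hN, R.set_set, R.get_set, if_pos hy]
  · rw [if_neg hy]
    refine Finset.sum_eq_zero fun c _ => ?_
    rw [hN, R.set_set, if_neg hy, mul_zero]

variable (R)

/-- The action of the map with Kraus operators `K l` on the region. -/
def apply {ι : Type} [Fintype ι] (K : ι → Matrix κ κ ℂ) (ρ : Oper n) : Oper n :=
  Matrix.of fun x y => ∑ c, ∑ d, (∑ l, K l (R.get x) c * star (K l (R.get y) d)) *
    ρ (R.set c x) (R.set d y)

variable {R}

theorem IsLift.conj_apply {M : Oper n} {A : Matrix κ κ ℂ} (h : R.IsLift M A) (ρ : Oper n)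
    (x y : Bits n) :
    conj M ρ x y = ∑ c, ∑ d, A (R.get x) c * star (A (R.get y) d) *
      ρ (R.set c x) (R.set d y) := by
  have h1 : ∀ y z, (M * ρ) y z = ∑ c, A (R.get y) c * ρ (R.set c y) z := fun y z => by
    rw [Matrix.mul_apply, h.sum_mul]
  -- Conjugating turns the right factor `Mᴴ` into a row of `M`, so that `sum_mul` applies on this
  -- side as well.
  have h2 : conj M ρ x y = star (∑ z, M y z * star ((M * ρ) x z)) := by
    rw [conj, Matrix.mul_apply, star_sum]
    refine Finset.sum_congr rfl fun z _ => ?_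
    rw [Matrix.conjTranspose_apply, star_mul, star_star]
  rw [h2, h.sum_mul, star_sum, Finset.sum_comm]
  refine Finset.sum_congr rfl fun d _ => ?_
  rw [star_mul, star_star, h1, Finset.sum_mul]
  refine Finset.sum_congr rfl fun c _ => ?_
  ring

theorem sum_conj_eq_apply {ι : Type} [Fintype ι] {M : ι → Oper n} {K : ι → Matrix κ κ ℂ}
    (h : ∀ l, R.IsLift (M l) (K l)) (ρ : Oper n) : ∑ l, conj (M l) ρ = R.apply K ρ := by
  ext x y
  simp_rw [Matrix.sum_apply, fun l => (h l).conj_apply ρ x y, apply, Matrix.of_apply,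
    Finset.sum_mul]
  rw [Finset.sum_comm]
  refine Finset.sum_congr rfl fun c _ => Finset.sum_comm

theorem card_smul_sum {M : Type*} [AddCommMonoid M] (g : Bits n → M) :
    Fintype.card κ • ∑ x, g x = ∑ x, ∑ c, g (R.set c x) := by
  rw [← R.sum_swap fun x _ => g x, Finset.smul_sum]
  simp

theorem trace_apply {ι : Type} [Fintype ι] {K : ι → Matrix κ κ ℂ} (hK : ∑ l, (K l)ᴴ * K l = 1)
    (ρ : Oper n) : (R.apply K ρ).trace = ρ.trace := by
  rcases isEmpty_or_nonempty (Bits n) with h | ⟨⟨x0⟩⟩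
  · simp [Matrix.trace]
  have hcard : (Fintype.card κ : ℂ) ≠ 0 :=
    Nat.cast_ne_zero.mpr (Fintype.card_pos_iff.mpr ⟨R.get x0⟩).ne'
  -- Multiplication by `|κ|` allows the region label of the diagonal index to be summed separately;
  -- this is the sum over the row index of `K` in `∑ Kᴴ K = 1`.
  refine mul_left_cancel₀ hcard ?_
  rw [← nsmul_eq_mul, ← nsmul_eq_mul, Matrix.trace, Matrix.trace, R.card_smul_sum, R.card_smul_sum]
  refine Finset.sum_congr rfl fun x _ => ?_
  simp only [Matrix.diag_apply, apply, Matrix.of_apply, R.get_set, R.set_set]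
  have hK' : ∀ d c, ∑ e, ∑ l, K l e c * star (K l e d) = if d = c then 1 else 0 := fun d c => by
    have := congrFun (congrFun hK d) c
    rw [Matrix.sum_apply, Matrix.one_apply] at this
    rw [← this, Finset.sum_comm]
    refine Finset.sum_congr rfl fun l _ => ?_
    rw [Matrix.mul_apply]
    refine Finset.sum_congr rfl fun e _ => ?_
    rw [Matrix.conjTranspose_apply, mul_comm]
  rw [Finset.sum_comm]
  refine Finset.sum_congr rfl fun c _ => ?_
  rw [Finset.sum_comm]
  simp_rw [← Finset.sum_mul, hK']
  simp

end Region

/-! ### Local gates and Kraus operators as lifts from a region -/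

theorem tensor_mul (A B : Fin n → Matrix (Fin 2) (Fin 2) ℂ) :
    tensor A * tensor B = tensor fun i => A i * B i := by
  ext x y
  simp only [tensor, Matrix.mul_apply, Matrix.of_apply, ← Finset.prod_mul_distrib]
  exact (Fintype.prod_sum fun i z => A i (x i) z * B i z (y i)).symm

theorem tensor_isLift (j : Fin n) (A : Fin n → Matrix (Fin 2) (Fin 2) ℂ)
    (hA : ∀ i, i ≠ j → A i = 1) : (region1 j).IsLift (tensor A) (A j) := by
  intro x y
  have hg : ∀ x, (region1 j).get x = x j := fun _ => rfl
  have hs : ∀ c x, (region1 j).set c x = Function.update x j c := fun _ _ => rfl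
  rw [hg, hg, hs, tensor, Matrix.of_apply, ← Finset.mul_prod_erase _ _ (Finset.mem_univ j)]
  split_ifs with h
  · rw [Finset.prod_eq_one, mul_one]
    intro i hi
    have hij := Finset.ne_of_mem_erase hi
    rw [hA i hij, h, Function.update_of_ne hij, Matrix.one_apply_eq]
  · have : ∃ i, i ≠ j ∧ x i ≠ y i := by
      by_contra! hc
      refine h (funext fun i => ?_)
      by_cases hi : i = j
      · subst hi; simp
      · rw [Function.update_of_ne hi, hc i hi]
    obtain ⟨i, hi, hxy⟩ := this
    rw [Finset.prod_eq_zero (Finset.mem_erase.mpr ⟨hi, Finset.mem_univ i⟩), mul_zero]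
    rw [hA i hi, Matrix.one_apply_ne hxy]

theorem embed1_isLift (j : Fin n) (A : Matrix (Fin 2) (Fin 2) ℂ) :
    (region1 j).IsLift (embed1 j A) A := by
  have := tensor_isLift j (fun i => if i = j then A else 1) fun i hi => if_neg hi
  simpa [embed1] using this

theorem gatesOn_singleton_isLift (j : Fin n) (V : Fin n → U2) :
    (region1 j).IsLift (gatesOn {j} V) (V j) := by
  have := tensor_isLift j (fun i => if i ∈ ({j} : Finset (Fin n)) then (V i).1 else 1)
    fun i hi => if_neg (by simpa using hi)
  simpa [gatesOn] using this

theorem embed2_isLift (i j : Fin n) (hij : i ≠ j)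
    (A : Matrix (Fin 2 × Fin 2) (Fin 2 × Fin 2) ℂ) :
    (region2 i j hij).IsLift (embed2 i j A) A := by
  intro x y
  have hg : ∀ x, (region2 i j hij).get x = (x i, x j) := fun _ => rfl
  have hs : ∀ c x, (region2 i j hij).set c x =
    Function.update (Function.update x i c.1) j c.2 := fun _ _ => rfl
  rw [hg, hg, hs, embed2, Matrix.of_apply]
  refine if_congr ⟨fun h => funext fun l => ?_, fun h l hi hj => ?_⟩ rfl rfl
  · by_cases hj : l = j
    · subst hj; simp
    · by_cases hi : l = i
      · subst hi; simp [hj]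
      · simp [hi, hj, h l hi hj]
  · rw [h]; simp [hi, hj]

theorem gatesOn_pair_isLift (i j : Fin n) (hij : i ≠ j) (V : Fin n → U2) :
    (region2 i j hij).IsLift (gatesOn {i, j} V)
      ((V i : Matrix (Fin 2) (Fin 2) ℂ) ⊗ₖ (V j : Matrix (Fin 2) (Fin 2) ℂ)) := by
  have h : gatesOn {i, j} V = embed2 i j
      ((V i : Matrix (Fin 2) (Fin 2) ℂ) ⊗ₖ (V j : Matrix (Fin 2) (Fin 2) ℂ)) := by
    ext x y
    rw [embed2, Matrix.of_apply, gatesOn, tensor, Matrix.of_apply,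
      ← Finset.mul_prod_erase _ _ (Finset.mem_univ i),
      ← Finset.mul_prod_erase _ _ (Finset.mem_erase.mpr ⟨hij.symm, Finset.mem_univ j⟩), ← mul_assoc]
    rw [if_pos (by simp), if_pos (by simp)]
    split_ifs with h
    · rw [Finset.prod_eq_one, mul_one]
      · simp
      · intro l hl
        have hj : l ≠ j := Finset.ne_of_mem_erase hl
        have hi : l ≠ i := Finset.ne_of_mem_erase (Finset.mem_of_mem_erase hl)
        rw [if_neg (by simp [hi, hj]), h l hi hj, Matrix.one_apply_eq]
    · push Not at h
      -- A single qubit outside the pair with different row and column labels makes the whole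
      -- product vanish.
      obtain ⟨l, hi, hj, hl⟩ := h
      rw [Finset.prod_eq_zero (i := l), mul_zero]
      · simp [hi, hj]
      · simp [hi, hj, hl]
  rw [h]
  exact embed2_isLift i j hij _

theorem conj_conj {ι : Type*} [Fintype ι] (A B ρ : Matrix ι ι ℂ) :
    conj A (conj B ρ) = conj (A * B) ρ := by
  simp [conj, Matrix.conjTranspose_mul, Matrix.mul_assoc]

theorem conj_sum {ι κ : Type*} [Fintype ι] [Fintype κ] (A : Matrix ι ι ℂ) (ρ : κ → Matrix ι ι ℂ) :
    conj A (∑ l, ρ l) = ∑ l, conj A (ρ l) := by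
  simp [conj, Matrix.mul_sum, Matrix.sum_mul]

/-! ### Bounded random variables and independence -/

/-- A bounded measurable complex function. -/
def BddMeas {Ω : Type*} [MeasurableSpace Ω] (f : Ω → ℂ) : Prop :=
  Measurable f ∧ ∃ B : ℝ, ∀ ω, ‖f ω‖ ≤ B

namespace BddMeas

variable {Ω : Type*} [MeasurableSpace Ω] {f g : Ω → ℂ}

theorem const (c : ℂ) : BddMeas fun _ : Ω => c := ⟨measurable_const, ‖c‖, fun _ => le_rfl⟩

theorem mul (hf : BddMeas f) (hg : BddMeas g) : BddMeas fun ω => f ω * g ω := by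
  obtain ⟨hf, B, hB⟩ := hf
  obtain ⟨hg, B', hB'⟩ := hg
  refine ⟨hf.mul hg, B * B', fun ω => ?_⟩
  rw [norm_mul]
  exact mul_le_mul (hB ω) (hB' ω) (norm_nonneg _) ((norm_nonneg _).trans (hB ω))

theorem add (hf : BddMeas f) (hg : BddMeas g) : BddMeas fun ω => f ω + g ω := by
  obtain ⟨hf, B, hB⟩ := hf
  obtain ⟨hg, B', hB'⟩ := hg
  exact ⟨hf.add hg, B + B', fun ω => (norm_add_le _ _).trans (add_le_add (hB ω) (hB' ω))⟩

theorem star (hf : BddMeas f) : BddMeas fun ω => star (f ω) := by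
  obtain ⟨hf, B, hB⟩ := hf
  exact ⟨continuous_star.measurable.comp hf, B, fun ω => by simpa using hB ω⟩

theorem sum {ι : Type*} (s : Finset ι) {f : ι → Ω → ℂ} (hf : ∀ i ∈ s, BddMeas (f i)) :
    BddMeas fun ω => ∑ i ∈ s, f i ω := by
  classical
  induction s using Finset.induction_on with
  | empty => simpa using const 0
  | insert a s ha ih =>
    simp_rw [Finset.sum_insert ha]
    exact (hf a (Finset.mem_insert_self a s)).add
      (ih fun i hi => hf i (Finset.mem_insert_of_mem hi))

theorem prod {ι : Type*} (s : Finset ι) {f : ι → Ω → ℂ} (hf : ∀ i ∈ s, BddMeas (f i)) :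
    BddMeas fun ω => ∏ i ∈ s, f i ω := by
  classical
  induction s using Finset.induction_on with
  | empty => simpa using const 1
  | insert a s ha ih =>
    simp_rw [Finset.prod_insert ha]
    exact (hf a (Finset.mem_insert_self a s)).mul
      (ih fun i hi => hf i (Finset.mem_insert_of_mem hi))

theorem comp {Ω' : Type*} [MeasurableSpace Ω'] (hf : BddMeas f) {u : Ω' → Ω} (hu : Measurable u) :
    BddMeas fun ω => f (u ω) := by
  obtain ⟨hf, B, hB⟩ := hf
  exact ⟨hf.comp hu, B, fun ω => hB _⟩

theorem integrable (hf : BddMeas f) (μ : Measure Ω) [IsFiniteMeasure μ] : Integrable f μ := by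
  obtain ⟨hf, B, hB⟩ := hf
  exact Integrable.of_bound hf.aestronglyMeasurable B (ae_of_all _ hB)

end BddMeas

/-- The map `u` rebuilds a sample point from prescribed values of all `X i`. Filling in the default
`b0` outside `S` exhibits `F` as a measurable function of the `X i` with `i ∈ S`, and likewise `G`
for `T`, so independence of disjoint subfamilies applies. -/
theorem indepFun_of_eqOn {ι Ω : Type*} {γ γ' : Type} {β : ι → Type*} [Finite ι]
    [MeasurableSpace Ω] [∀ i, MeasurableSpace (β i)] [MeasurableSpace γ] [MeasurableSpace γ']
    {μ : Measure Ω} {X : ∀ i, Ω → β i} (hX : iIndepFun X μ) (hXm : ∀ i, Measurable (X i))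
    {u : (∀ i, β i) → Ω} (hu : Measurable u) (hXu : ∀ b i, X i (u b) = b i)
    {S T : Set ι} (hST : Disjoint S T) (b0 : ∀ i, β i)
    {F : Ω → γ} {G : Ω → γ'} (hF : Measurable F) (hG : Measurable G)
    (hFS : ∀ ω ω', (∀ i ∈ S, X i ω = X i ω') → F ω = F ω')
    (hGT : ∀ ω ω', (∀ i ∈ T, X i ω = X i ω') → G ω = G ω') : IndepFun F G μ := by
  classical
  have key : ∀ {γ : Type} [MeasurableSpace γ] (S : Finset ι) (F : Ω → γ), Measurable F →
      (∀ ω ω', (∀ i ∈ S, X i ω = X i ω') → F ω = F ω') →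
      ∃ F' : (∀ i : S, β i) → γ, Measurable F' ∧ F = F' ∘ fun ω (i : S) => X i ω := by
    intro γ _ S F hF hFS
    refine ⟨fun b => F (u fun i => if h : i ∈ S then b ⟨i, h⟩ else b0 i), ?_, ?_⟩
    · refine hF.comp (hu.comp (measurable_pi_iff.mpr fun i => ?_))
      by_cases h : i ∈ S
      · simp only [h, dite_true]; exact measurable_pi_apply _
      · simp only [h, dite_false]; exact measurable_const
    · funext ω
      refine hFS _ _ fun i hi => ?_
      rw [hXu, dif_pos hi]
  obtain ⟨F', hF', rfl⟩ := key S.toFinite.toFinset F hF (by simpa using hFS)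
  obtain ⟨G', hG', rfl⟩ := key T.toFinite.toFinset G hG (by simpa using hGT)
  exact (hX.indepFun_finset _ _ (by simpa using hST) hXm).comp hF' hG'

/-- The space of parameters and inserted gates. -/
abbrev Sample (n p m : ℕ) : Type := (Fin p → ℝ) × (Place n m → U2)

/-- The function depends only on the parameters owned by `S` and the gates inserted at `T`. -/
def DepOn {β : Type*} (owner : Fin p → Fin m) (S : Set (Fin m)) (T : Set (Place n m))
    (F : Sample n p m → β) : Prop :=
  ∀ ω ω' : Sample n p m, (∀ i, owner i ∈ S → ω.1 i = ω'.1 i) → (∀ q ∈ T, ω.2 q = ω'.2 q) →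
    F ω = F ω'

/-- The parameter blocks of distinct owners are independent. -/
def BlockIndep (owner : Fin p → Fin m) (D : Measure (Fin p → ℝ)) : Prop :=
  iIndepFun (fun (s : Fin m) (θ : Fin p → ℝ) (i : {i // owner i = s}) => θ i) D

theorem DepOn.mono {β : Type*} {owner : Fin p → Fin m} {S S' : Set (Fin m)}
    {T T' : Set (Place n m)} {F : Sample n p m → β} (h : DepOn owner S T F) (hS : S ⊆ S')
    (hT : T ⊆ T') : DepOn owner S' T' F :=
  fun ω ω' h1 h2 => h ω ω' (fun i hi => h1 i (hS hi)) (fun q hq => h2 q (hT hq))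

/-- Fubini in two layers: for fixed parameters the two factors see disjoint sets of inserted gates,
and the remaining functions of `θ` see disjoint parameter blocks. The law `D` itself need not be a
product over single components. -/
theorem integral_mul_of_depOn {owner : Fin p → Fin m} {D : Measure (Fin p → ℝ)}
    [IsProbabilityMeasure D] (hD : BlockIndep owner D) (E : Measure U2) [IsProbabilityMeasure E]
    {S S' : Set (Fin m)} {T T' : Set (Place n m)} (hS : Disjoint S S') (hT : Disjoint T T')
    {F G : Sample n p m → ℂ} (hF : BddMeas F) (hG : BddMeas G)
    (hFd : DepOn owner S T F) (hGd : DepOn owner S' T' G) :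
    ∫ ω, F ω * G ω ∂(D.prod (Measure.pi fun _ => E)) =
      (∫ ω, F ω ∂(D.prod (Measure.pi fun _ => E))) *
        ∫ ω, G ω ∂(D.prod (Measure.pi fun _ => E)) := by
  have hVm : ∀ θ : Fin p → ℝ, Measurable fun V : Place n m → U2 => (θ, V) :=
    fun θ => measurable_prodMk_left
  rw [integral_prod _ ((hF.mul hG).integrable _), integral_prod _ (hF.integrable _),
    integral_prod _ (hG.integrable _)]
  have hinner : ∀ θ, ∫ V, F (θ, V) * G (θ, V) ∂(Measure.pi fun _ => E) =
      (∫ V, F (θ, V) ∂(Measure.pi fun _ => E)) * ∫ V, G (θ, V) ∂(Measure.pi fun _ => E) := by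
    intro θ
    have hpi : iIndepFun (fun (q : Place n m) (V : Place n m → U2) => V q)
        (Measure.pi fun _ => E) :=
      iIndepFun_pi (μ := fun _ : Place n m => E) (X := fun _ V => V) fun _ => aemeasurable_id
    refine IndepFun.integral_fun_mul_eq_mul_integral ?_
      ((hF.comp (hVm θ)).1.aestronglyMeasurable) ((hG.comp (hVm θ)).1.aestronglyMeasurable)
    exact indepFun_of_eqOn hpi (fun q => measurable_pi_apply q) measurable_id (fun _ _ => rfl) hT
      (fun _ => 1) (hF.comp (hVm θ)).1 (hG.comp (hVm θ)).1
      (fun V V' h => hFd _ _ (fun _ _ => rfl) h) (fun V V' h => hGd _ _ (fun _ _ => rfl) h)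
  simp_rw [hinner]
  have hmF : Measurable fun θ => ∫ V, F (θ, V) ∂(Measure.pi fun _ : Place n m => E) :=
    (hF.1.stronglyMeasurable.integral_prod_right').measurable
  have hmG : Measurable fun θ => ∫ V, G (θ, V) ∂(Measure.pi fun _ : Place n m => E) :=
    (hG.1.stronglyMeasurable.integral_prod_right').measurable
  refine IndepFun.integral_fun_mul_eq_mul_integral ?_ hmF.aestronglyMeasurable
    hmG.aestronglyMeasurable
  refine indepFun_of_eqOn hD
    (fun s => measurable_pi_iff.mpr fun i => measurable_pi_apply _)
    (u := fun b i => b (owner i) ⟨i, rfl⟩)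
    (measurable_pi_iff.mpr fun i => (measurable_pi_apply _).comp (measurable_pi_apply _))
    ?_ hS (fun _ _ => 0) hmF hmG ?_ ?_
  · intro b s
    funext ⟨i, hi⟩
    subst hi
    rfl
  · intro θ θ' h
    refine integral_congr_ae (ae_of_all _ fun V => hFd _ _ (fun i hi => ?_) fun _ _ => rfl)
    exact congrFun (h _ hi) ⟨i, rfl⟩
  · intro θ θ' h
    refine integral_congr_ae (ae_of_all _ fun V => hGd _ _ (fun i hi => ?_) fun _ _ => rfl)
    exact congrFun (h _ hi) ⟨i, rfl⟩

/-! ### Second moments of random operators -/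

/-- The random operator `F` has second moment `∑ v, w v • siteWord v`. -/
structure HasMoments (owner : Fin p → Fin m) (D : Measure (Fin p → ℝ)) (E : Measure U2)
    (F : Sample n p m → Oper n) (S : Set (Fin m)) (T : Set (Place n m)) (w : Bits n → ℝ) :
    Prop where
  bdd : ∀ x y, BddMeas fun ω => F ω x y
  dep : DepOn owner S T F
  trace : ∀ ω, (F ω).trace = 1
  moment : ∀ x x' y y', ∫ ω, F ω x y * F ω x' y' ∂(D.prod (Measure.pi fun _ => E)) =
    ∑ v, (w v : ℂ) * siteWord v x x' y y'

/-- The measure obtained by applying the transfer matrix `T` on a region. -/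
def Region.push {κ : Type} [Fintype κ] [DecidableEq κ] (R : Region n κ) (T : Matrix κ κ ℝ)
    (w : Bits n → ℝ) : Bits n → ℝ := fun v => ∑ c, T (R.get v) c * w (R.set c v)

theorem sum_conj_kronecker {κ ι : Type} [Fintype κ] [DecidableEq κ] [Fintype ι]
    (K : ι → Matrix κ κ ℂ) (X : Matrix (κ × κ) (κ × κ) ℂ) (a a' b b' : κ) :
    (∑ l, ∑ l', conj (K l ⊗ₖ K l') X) (a, a') (b, b') =
      ∑ c, ∑ d, ∑ c', ∑ d', (∑ l, K l a c * star (K l b d)) *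
        (∑ l, K l a' c' * star (K l b' d')) * X (c, c') (d, d') := by
  have h : ∀ l l', conj (K l ⊗ₖ K l') X (a, a') (b, b') =
      ∑ c, ∑ d, ∑ c', ∑ d', (K l a c * star (K l b d)) * (K l' a' c' * star (K l' b' d')) *
        X (c, c') (d, d') := by
    intro l l'
    simp only [conj, Matrix.mul_apply, Matrix.conjTranspose_apply, Matrix.kroneckerMap_apply,
      Finset.sum_mul, Fintype.sum_prod_type, star_mul]
    rw [Finset.sum_congr rfl fun d _ => Finset.sum_comm, Finset.sum_comm]
    refine Finset.sum_congr rfl fun c _ => Finset.sum_congr rfl fun d _ => ?_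
    rw [Finset.sum_comm]
    refine Finset.sum_congr rfl fun c' _ => Finset.sum_congr rfl fun d' _ => ?_
    ring
  have hc : ∀ f : ι → κ → ℂ, ∑ l, ∑ c, f l c = ∑ c, ∑ l, f l c := fun f => Finset.sum_comm
  simp only [Matrix.sum_apply, h, hc, Finset.sum_mul_sum, ← Finset.sum_mul]

theorem sum_sum_mul_sum_sum {κ : Type} [Fintype κ] (k f k' f' : κ → κ → ℂ) :
    (∑ c, ∑ d, k c d * f c d) * (∑ c, ∑ d, k' c d * f' c d) =
      ∑ c, ∑ d, ∑ c', ∑ d', (k c d * k' c' d') * (f c d * f' c' d') := by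
  simp only [Finset.sum_mul]
  simp only [Finset.mul_sum]
  refine Finset.sum_congr rfl fun c _ => Finset.sum_congr rfl fun d _ =>
    Finset.sum_congr rfl fun c' _ => Finset.sum_congr rfl fun d' _ => ?_
  ring

theorem integral_sum_of_bddMeas {Ω ι : Type*} [MeasurableSpace Ω] (μ : Measure Ω)
    [IsFiniteMeasure μ] (s : Finset ι) {f : ι → Ω → ℂ} (hf : ∀ i, BddMeas (f i)) :
    ∫ ω, ∑ i ∈ s, f i ω ∂μ = ∑ i ∈ s, ∫ ω, f i ω ∂μ :=
  integral_finsetSum _ fun i _ => (hf i).integrable μ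

theorem integral_sum4_of_bddMeas {Ω κ κ' : Type*} [Fintype κ] [Fintype κ'] [MeasurableSpace Ω]
    (μ : Measure Ω) [IsFiniteMeasure μ] {f : κ → κ → κ' → κ' → Ω → ℂ}
    (hf : ∀ a b c d, BddMeas (f a b c d)) :
    ∫ ω, ∑ a, ∑ b, ∑ c, ∑ d, f a b c d ω ∂μ = ∑ a, ∑ b, ∑ c, ∑ d, ∫ ω, f a b c d ω ∂μ := by
  rw [integral_sum_of_bddMeas μ _ fun a => BddMeas.sum _ fun b _ => BddMeas.sum _ fun c _ =>
    BddMeas.sum _ fun d _ => hf a b c d]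
  refine Finset.sum_congr rfl fun a _ => ?_
  rw [integral_sum_of_bddMeas μ _ fun b => BddMeas.sum _ fun c _ =>
    BddMeas.sum _ fun d _ => hf a b c d]
  refine Finset.sum_congr rfl fun b _ => ?_
  rw [integral_sum_of_bddMeas μ _ fun c => BddMeas.sum _ fun d _ => hf a b c d]
  refine Finset.sum_congr rfl fun c _ => ?_
  rw [integral_sum_of_bddMeas μ _ fun d => hf a b c d]

/-- Expanding both copies separates a product of Kraus kernels from a product of entries of `F`, and
independence factors the expectation. In each site word the factor on the region absorbs the
averaged two-copy channel, which `ht` replaces by a column of `t`; the factor off the region is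
untouched. -/
theorem HasMoments.apply {owner : Fin p → Fin m} {D : Measure (Fin p → ℝ)}
    [IsProbabilityMeasure D] (hD : BlockIndep owner D) {E : Measure U2} [IsProbabilityMeasure E]
    {F : Sample n p m → Oper n} {S S' : Set (Fin m)} {T T' : Set (Place n m)} {w : Bits n → ℝ}
    (hF : HasMoments owner D E F S T w) {κ ι : Type} [Fintype κ] [DecidableEq κ] [Fintype ι]
    (R : Region n κ) {K : Sample n p m → ι → Matrix κ κ ℂ}
    (hK : ∀ l a b, BddMeas fun ω => K ω l a b) (hKd : DepOn owner S' T' K)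
    (hS : Disjoint S S') (hT : Disjoint T T') (hK1 : ∀ ω, ∑ l, (K ω l)ᴴ * K ω l = 1)
    {t : Matrix κ κ ℝ}
    (ht : ∀ e a a' b b', ∫ ω, (∑ l, ∑ l', conj (K ω l ⊗ₖ K ω l') (R.localSite e)) (a, a') (b, b')
        ∂(D.prod (Measure.pi fun _ => E)) =
      ∑ e', (t e' e : ℂ) * R.localSite e' (a, a') (b, b')) :
    HasMoments owner D E (fun ω => R.apply (K ω) (F ω)) (S ∪ S') (T ∪ T') (R.push t w) where
  bdd x y := by
    simp only [Region.apply, Matrix.of_apply]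
    exact BddMeas.sum _ fun c _ => BddMeas.sum _ fun d _ =>
      (BddMeas.sum _ fun l _ => (hK _ _ _).mul (hK _ _ _).star).mul (hF.bdd _ _)
  dep ω ω' h1 h2 := by
    have e1 := hF.dep ω ω' (fun i hi => h1 i (Or.inl hi)) fun q hq => h2 q (Or.inl hq)
    have e2 := hKd ω ω' (fun i hi => h1 i (Or.inr hi)) fun q hq => h2 q (Or.inr hq)
    simp only [e1, e2]
  trace ω := by rw [Region.trace_apply (hK1 ω), hF.trace]
  moment x x' y y' := by
    have hk : ∀ a b c d, BddMeas fun ω => ∑ l, K ω l a c * star (K ω l b d) := fun a b c d =>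
      BddMeas.sum _ fun l _ => (hK _ _ _).mul (hK _ _ _).star
    have hkd : ∀ a b c d a' b' c' d', DepOn owner S' T' fun ω =>
        (∑ l, K ω l a c * star (K ω l b d)) * (∑ l, K ω l a' c' * star (K ω l b' d')) :=
      fun a b c d a' b' c' d' ω ω' h1 h2 => by simp only [hKd ω ω' h1 h2]
    have hFd : ∀ x y x' y', DepOn owner S T fun ω => F ω x y * F ω x' y' :=
      fun x y x' y' ω ω' h1 h2 => by simp only [hF.dep ω ω' h1 h2]
    have hexp : ∀ ω, R.apply (K ω) (F ω) x y * R.apply (K ω) (F ω) x' y' =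
        ∑ c, ∑ d, ∑ c', ∑ d', ((∑ l, K ω l (R.get x) c * star (K ω l (R.get y) d)) *
          (∑ l, K ω l (R.get x') c' * star (K ω l (R.get y') d'))) *
          (F ω (R.set c x) (R.set d y) * F ω (R.set c' x') (R.set d' y')) := by
      intro ω
      simp only [Region.apply, Matrix.of_apply]
      exact sum_sum_mul_sum_sum _ _ _ _
    simp_rw [hexp]
    rw [integral_sum4_of_bddMeas _ fun c d c' d' =>
      ((hk _ _ _ _).mul (hk _ _ _ _)).mul ((hF.bdd _ _).mul (hF.bdd _ _))]
    have hfac : ∀ v c c' d d', siteWord v (R.set c x) (R.set c' x') (R.set d y) (R.set d' y') =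
        R.localSite (R.get v) (c, c') (d, d') * R.rest v x x' y y' := fun v c c' d d' => by
      rw [← R.factor, R.set_get]
    have hfac' : ∀ v e, siteWord (R.set e v) x x' y y' =
        R.localSite e (R.get x, R.get x') (R.get y, R.get y') * R.rest v x x' y y' := fun v e => by
      rw [← R.factor, R.set_get, R.set_get, R.set_get, R.set_get]
    set P := D.prod (Measure.pi fun _ : Place n m => E)
    have hkk : ∀ v, ∑ c, ∑ d, ∑ c', ∑ d',
        (∫ ω, (∑ l, K ω l (R.get x) c * star (K ω l (R.get y) d)) *
          (∑ l, K ω l (R.get x') c' * star (K ω l (R.get y') d')) ∂P) *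
          R.localSite (R.get v) (c, c') (d, d') =
        ∑ e, (t e (R.get v) : ℂ) *
          R.localSite e (R.get x, R.get x') (R.get y, R.get y') := by
      intro v
      rw [← ht]
      simp_rw [sum_conj_kronecker]
      rw [integral_sum4_of_bddMeas _ fun c d c' d' =>
        ((hk _ _ _ _).mul (hk _ _ _ _)).mul (BddMeas.const _)]
      simp_rw [integral_mul_const]
    calc _ = ∑ c, ∑ d, ∑ c', ∑ d',
          (∫ ω, (∑ l, K ω l (R.get x) c * star (K ω l (R.get y) d)) *
            (∑ l, K ω l (R.get x') c' * star (K ω l (R.get y') d')) ∂P) *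
          ∑ v, (w v : ℂ) * (R.localSite (R.get v) (c, c') (d, d') * R.rest v x x' y y') := by
          refine Finset.sum_congr rfl fun c _ => Finset.sum_congr rfl fun d _ =>
            Finset.sum_congr rfl fun c' _ => Finset.sum_congr rfl fun d' _ => ?_
          rw [integral_mul_of_depOn hD E hS.symm hT.symm ((hk _ _ _ _).mul (hk _ _ _ _))
            ((hF.bdd _ _).mul (hF.bdd _ _)) (hkd _ _ _ _ _ _ _ _) (hFd _ _ _ _), hF.moment]
          simp_rw [hfac]
          rfl
      _ = ∑ v, (w v : ℂ) * R.rest v x x' y y' * ∑ e, (t e (R.get v) : ℂ) *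
          R.localSite e (R.get x, R.get x') (R.get y, R.get y') := by
          simp_rw [← hkk, Finset.mul_sum]
          have hc : ∀ f : κ → Bits n → ℂ, ∑ c, ∑ v, f c v = ∑ v, ∑ c, f c v :=
            fun f => Finset.sum_comm
          simp only [hc]
          refine Finset.sum_congr rfl fun v _ => Finset.sum_congr rfl fun c _ =>
            Finset.sum_congr rfl fun d _ => Finset.sum_congr rfl fun c' _ =>
            Finset.sum_congr rfl fun d' _ => ?_
          ring
      _ = ∑ v, ∑ e, (w v : ℂ) * (t e (R.get v) : ℂ) * siteWord (R.set e v) x x' y y' := by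
          refine Finset.sum_congr rfl fun v _ => ?_
          rw [Finset.mul_sum]
          refine Finset.sum_congr rfl fun e _ => ?_
          rw [hfac']
          ring
      _ = _ := by
          -- The new label `e` becomes part of the configuration, and the old one becomes the
          -- summation index of `Region.push`.
          rw [R.sum_swap]
          refine Finset.sum_congr rfl fun v _ => ?_
          simp only [Region.push, R.get_set, R.set_set, R.set_get, Complex.ofReal_sum,
            Complex.ofReal_mul, Finset.sum_mul]
          refine Finset.sum_congr rfl fun e _ => ?_
          ring

/-! ### Haar averages and 2-designs -/

instance : IsProbabilityMeasure haarU2 := ⟨by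
  have := Measure.haarMeasure_self (K₀ := (⊤ : TopologicalSpace.PositiveCompacts U2))
  simpa [haarU2] using this⟩

instance : haarU2.IsMulLeftInvariant := by
  unfold haarU2
  infer_instance

theorem bddMeas_of_norm_le_one {Ω : Type*} [MeasurableSpace Ω] {f : Ω → ℂ} (hf : Measurable f)
    (h : ∀ ω, ‖f ω‖ ≤ 1) : BddMeas f := ⟨hf, 1, h⟩

theorem bddMeas_entry (a b : Fin 2) : BddMeas fun V : U2 => (V : Matrix (Fin 2) (Fin 2) ℂ) a b :=
  bddMeas_of_norm_le_one
    ((continuous_subtype_val.matrix_elem a b).measurable)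
    fun V => entry_norm_bound_of_unitary V.2 a b

theorem conj_kronecker_apply {κ : Type} [Fintype κ] [DecidableEq κ]
    (A : Matrix κ κ ℂ) (X : Matrix (κ × κ) (κ × κ) ℂ) (a a' b b' : κ) :
    conj (A ⊗ₖ A) X (a, a') (b, b') =
      ∑ c, ∑ d, ∑ c', ∑ d', (A a c * star (A b d)) * (A a' c' * star (A b' d')) *
        X (c, c') (d, d') := by
  simpa using sum_conj_kronecker (fun _ : Unit => A) X a a' b b'

theorem bddMeas_fourth {κ Ω : Type} [MeasurableSpace Ω] {A : Ω → Matrix κ κ ℂ}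
    (hA : ∀ a b, BddMeas fun ω => A ω a b) (a a' b b' c c' d d' : κ) :
    BddMeas fun ω => (A ω a c * star (A ω b d)) * (A ω a' c' * star (A ω b' d')) :=
  ((hA _ _).mul (hA _ _).star).mul ((hA _ _).mul (hA _ _).star)

theorem bddMeas_conj_kronecker {κ Ω : Type} [Fintype κ] [DecidableEq κ] [MeasurableSpace Ω]
    {A : Ω → Matrix κ κ ℂ} (hA : ∀ a b, BddMeas fun ω => A ω a b)
    (X : Matrix (κ × κ) (κ × κ) ℂ) (a b : κ × κ) :
    BddMeas fun ω => conj (A ω ⊗ₖ A ω) X a b := by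
  obtain ⟨a, a'⟩ := a
  obtain ⟨b, b'⟩ := b
  simp_rw [conj_kronecker_apply]
  exact BddMeas.sum _ fun c _ => BddMeas.sum _ fun d _ => BddMeas.sum _ fun c' _ =>
    BddMeas.sum _ fun d' _ => (bddMeas_fourth hA _ _ _ _ _ _ _ _).mul (BddMeas.const _)

theorem integral_conj_kronecker {κ Ω : Type} [Fintype κ] [DecidableEq κ] [MeasurableSpace Ω]
    (μ : Measure Ω) [IsFiniteMeasure μ] {A : Ω → Matrix κ κ ℂ}
    (hA : ∀ a b, BddMeas fun ω => A ω a b) (X : Matrix (κ × κ) (κ × κ) ℂ) (a a' b b' : κ) :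
    ∫ ω, conj (A ω ⊗ₖ A ω) X (a, a') (b, b') ∂μ =
      ∑ c, ∑ d, ∑ c', ∑ d',
        (∫ ω, (A ω a c * star (A ω b d)) * (A ω a' c' * star (A ω b' d')) ∂μ) *
        X (c, c') (d, d') := by
  simp_rw [conj_kronecker_apply]
  rw [integral_sum4_of_bddMeas _ fun c d c' d' =>
    (bddMeas_fourth hA _ _ _ _ _ _ _ _).mul (BddMeas.const _)]
  simp_rw [integral_mul_const]

theorem twirl_eq (μ : Measure U2) (O : Matrix (Fin 2 × Fin 2) (Fin 2 × Fin 2) ℂ)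
    (a b : Fin 2 × Fin 2) :
    twirl μ O a b = ∫ V, conj ((V : Matrix (Fin 2) (Fin 2) ℂ) ⊗ₖ (V : Matrix (Fin 2) (Fin 2) ℂ)) O
      a b ∂μ := rfl

/-- On a matrix unit, each entry of the twirl is a single monomial of this kind. The entrywise form
is needed for pairs of qubits, where the moments of two independent gates multiply. -/
theorem IsTwoDesign.integral_fourth {E : Measure U2} (hE : IsTwoDesign E)
    (a a' b b' c c' d d' : Fin 2) :
    ∫ V : U2, (V.1 a c * star (V.1 b d)) * (V.1 a' c' * star (V.1 b' d')) ∂E =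
      ∫ V : U2, (V.1 a c * star (V.1 b d)) * (V.1 a' c' * star (V.1 b' d')) ∂haarU2 := by
  have h : ∀ (μ : Measure U2) [IsFiniteMeasure μ],
      twirl μ (Matrix.single (c, c') (d, d') 1) (a, a') (b, b') =
      ∫ V : U2, (V.1 a c * star (V.1 b d)) * (V.1 a' c' * star (V.1 b' d')) ∂μ := by
    intro μ _
    rw [twirl_eq, integral_conj_kronecker μ bddMeas_entry, Finset.sum_eq_single c,
      Finset.sum_eq_single d, Finset.sum_eq_single c', Finset.sum_eq_single d']
    · simp
    all_goals
      intros
      first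
      | (exfalso; simp_all; done)
      | skip
    all_goals simp_all [Matrix.single_apply]
    all_goals simp_all [eq_comm]
  have := hE.1
  rw [← h, ← h, hE.2]

theorem dressed_apply (V : U2 × U2) (U : U4) : dressed V U =
    ((V.1 : Matrix (Fin 2) (Fin 2) ℂ) ⊗ₖ (V.2 : Matrix (Fin 2) (Fin 2) ℂ)) * U.1 := rfl

theorem bddMeas_kronecker (a b : Fin 2 × Fin 2) : BddMeas fun V : U2 × U2 =>
    ((V.1 : Matrix (Fin 2) (Fin 2) ℂ) ⊗ₖ (V.2 : Matrix (Fin 2) (Fin 2) ℂ)) a b := by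
  simp only [Matrix.kroneckerMap_apply]
  exact ((bddMeas_entry _ _).comp measurable_fst).mul ((bddMeas_entry _ _).comp measurable_snd)

/-- A pair of independent gates of a 2-design averages a dressed gate as Haar random gates do. -/
theorem IsTwoDesign.integral_dressed {E : Measure U2} (hE : IsTwoDesign E) (U : U4)
    (X : Matrix ((Fin 2 × Fin 2) × (Fin 2 × Fin 2)) ((Fin 2 × Fin 2) × (Fin 2 × Fin 2)) ℂ)
    (a b : (Fin 2 × Fin 2) × (Fin 2 × Fin 2)) :
    ∫ V, conj (dressed V U ⊗ₖ dressed V U) X a b ∂(E.prod E) =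
      ∫ V, conj (dressed V U ⊗ₖ dressed V U) X a b ∂(haarU2.prod haarU2) := by
  have := hE.1
  have h : ∀ V, conj (dressed V U ⊗ₖ dressed V U) X =
      conj ((V.1.1 ⊗ₖ V.2.1) ⊗ₖ (V.1.1 ⊗ₖ V.2.1)) (conj (U.1 ⊗ₖ U.1) X) := fun V => by
    rw [conj_conj, dressed_apply, Matrix.mul_kronecker_mul]
  simp_rw [h]
  obtain ⟨a, a'⟩ := a
  obtain ⟨b, b'⟩ := b
  rw [integral_conj_kronecker _ bddMeas_kronecker, integral_conj_kronecker _ bddMeas_kronecker]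
  refine Finset.sum_congr rfl fun c _ => Finset.sum_congr rfl fun d _ =>
    Finset.sum_congr rfl fun c' _ => Finset.sum_congr rfl fun d' _ => ?_
  congr 1
  have hsplit : ∀ V : U2 × U2, ((V.1.1 ⊗ₖ V.2.1) a c * star ((V.1.1 ⊗ₖ V.2.1) b d)) *
      ((V.1.1 ⊗ₖ V.2.1) a' c' * star ((V.1.1 ⊗ₖ V.2.1) b' d')) =
      ((V.1.1 a.1 c.1 * star (V.1.1 b.1 d.1)) * (V.1.1 a'.1 c'.1 * star (V.1.1 b'.1 d'.1))) *
      ((V.2.1 a.2 c.2 * star (V.2.1 b.2 d.2)) * (V.2.1 a'.2 c'.2 * star (V.2.1 b'.2 d'.2))) := by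
    intro V
    simp only [Matrix.kroneckerMap_apply, star_mul']
    ring
  simp_rw [hsplit]
  rw [integral_prod_mul (fun V : U2 => (V.1 a.1 c.1 * star (V.1 b.1 d.1)) *
      (V.1 a'.1 c'.1 * star (V.1 b'.1 d'.1))) (fun V : U2 => (V.1 a.2 c.2 * star (V.1 b.2 d.2)) *
      (V.1 a'.2 c'.2 * star (V.1 b'.2 d'.2))),
    integral_prod_mul (fun V : U2 => (V.1 a.1 c.1 * star (V.1 b.1 d.1)) *
      (V.1 a'.1 c'.1 * star (V.1 b'.1 d'.1))) (fun V : U2 => (V.1 a.2 c.2 * star (V.1 b.2 d.2)) *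
      (V.1 a'.2 c'.2 * star (V.1 b'.2 d'.2))), hE.integral_fourth, hE.integral_fourth]

/-! ### The commutant of `V ⊗ V` and the one-qubit Haar twirl -/

/-- The exchange of the two copies of one qubit. -/
def swapOp : Matrix (Fin 2 × Fin 2) (Fin 2 × Fin 2) ℂ :=
  Matrix.of fun a b => if a.1 = b.2 ∧ a.2 = b.1 then 1 else 0

theorem site_zero : site 0 = (1 / 4 : ℂ) • 1 := rfl

theorem site_one : site 1 = (1 / 2 : ℂ) • swapOp := rfl

theorem swapOp_mul_kronecker (A : Matrix (Fin 2) (Fin 2) ℂ) :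
    swapOp * (A ⊗ₖ A) = (A ⊗ₖ A) * swapOp := by
  ext ⟨a, a'⟩ ⟨b, b'⟩
  fin_cases a <;> fin_cases a' <;> fin_cases b <;> fin_cases b' <;>
    simp [swapOp, Matrix.mul_apply, Fintype.sum_prod_type] <;> ring

theorem kronecker_self_mem_unitary (V : U2) :
    ((V.1 ⊗ₖ V.1)ᴴ * (V.1 ⊗ₖ V.1) : Matrix _ _ ℂ) = 1 ∧
    ((V.1 ⊗ₖ V.1) * (V.1 ⊗ₖ V.1)ᴴ : Matrix _ _ ℂ) = 1 := by
  have h1 : V.1ᴴ * V.1 = 1 := Matrix.mem_unitaryGroup_iff'.mp V.2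
  have h2 : V.1 * V.1ᴴ = 1 := Matrix.mem_unitaryGroup_iff.mp V.2
  rw [Matrix.conjTranspose_kronecker, ← Matrix.mul_kronecker_mul, ← Matrix.mul_kronecker_mul,
    h1, h2, Matrix.one_kronecker_one]
  exact ⟨rfl, rfl⟩

theorem conj_site (V : U2) (e : Fin 2) : conj (V.1 ⊗ₖ V.1) (site e) = site e := by
  have h := (kronecker_self_mem_unitary V).2
  fin_cases e
  · simp [site_zero, conj, h]
  · simp only [Fin.mk_one, site_one, conj, Matrix.mul_smul, Matrix.smul_mul]
    rw [← swapOp_mul_kronecker, Matrix.mul_assoc, h, Matrix.mul_one]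

/-- Left invariance of Haar measure, after the linear map `conj (W ⊗ W)` is taken inside the
integral. -/
theorem conj_twirl_haar (W : U2) (O : Matrix (Fin 2 × Fin 2) (Fin 2 × Fin 2) ℂ) :
    conj (W.1 ⊗ₖ W.1) (twirl haarU2 O) = twirl haarU2 O := by
  ext ⟨a, a'⟩ ⟨b, b'⟩
  have hb : ∀ a b, BddMeas fun V : U2 => conj (V.1 ⊗ₖ V.1) O a b :=
    bddMeas_conj_kronecker bddMeas_entry O
  have h1 : conj (W.1 ⊗ₖ W.1) (twirl haarU2 O) (a, a') (b, b') =
      ∫ V : U2, conj (W.1 ⊗ₖ W.1) (conj (V.1 ⊗ₖ V.1) O) (a, a') (b, b') ∂haarU2 := by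
    simp_rw [conj_kronecker_apply W.1]
    rw [integral_sum4_of_bddMeas _ fun c d c' d' => (BddMeas.const _).mul (hb _ _)]
    simp_rw [integral_const_mul]
    rfl
  rw [h1, twirl_eq]
  refine Eq.trans ?_ (integral_mul_left_eq_self
    (fun V : U2 => conj (V.1 ⊗ₖ V.1) O (a, a') (b, b')) W)
  refine integral_congr_ae (ae_of_all _ fun V => ?_)
  simp only [conj_conj]
  rw [← Matrix.mul_kronecker_mul]
  rfl

/-- Three unitaries suffice to determine the commutant. The gate `diag(1, i)` kills all entries
between basis states with different numbers of ones; the bit flip identifies the entries exchanged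
by complementing both labels; and a rotation relates the `(0,0)` diagonal entry to the middle block.
The rotation is the 3-4-5 one, so that its entries are rational. -/
theorem eq_one_add_swap_of_commute (M : Matrix (Fin 2 × Fin 2) (Fin 2 × Fin 2) ℂ)
    (hM : ∀ W : U2, conj (W.1 ⊗ₖ W.1) M = M) :
    M = M (0, 1) (0, 1) • 1 + M (0, 1) (1, 0) • swapOp := by
  have hcomm : ∀ W : U2, (W.1 ⊗ₖ W.1) * M = M * (W.1 ⊗ₖ W.1) := fun W => by
    conv_rhs => rw [← hM W, conj, Matrix.mul_assoc, (kronecker_self_mem_unitary W).1,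
      Matrix.mul_one]
  have hx := hcomm ⟨!![0, 1; 1, 0], Matrix.mem_unitaryGroup_iff.mpr (by
    ext i j; fin_cases i <;> fin_cases j <;> simp [Matrix.mul_apply])⟩
  have hz := hcomm ⟨!![1, 0; 0, Complex.I], Matrix.mem_unitaryGroup_iff.mpr (by
    ext i j; fin_cases i <;> fin_cases j <;> simp [Matrix.mul_apply])⟩
  have hr := hcomm ⟨!![3 / 5, 4 / 5; -4 / 5, 3 / 5], Matrix.mem_unitaryGroup_iff.mpr (by
    ext i j; fin_cases i <;> fin_cases j <;> simp [Matrix.mul_apply, Complex.conj_ofNat] <;> norm_num)⟩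
  have h1 : (1 : ℂ) - Complex.I ≠ 0 := fun h => by simpa using congrArg Complex.re h
  have h2 : (1 : ℂ) + Complex.I ≠ 0 := fun h => by simpa using congrArg Complex.re h
  have ez := fun a b => congrFun (congrFun hz a) b
  have ex := fun a b => congrFun (congrFun hx a) b
  have er := congrFun (congrFun hr (0, 0)) (0, 1)
  simp only [Matrix.mul_apply, Fintype.sum_prod_type, Fin.sum_univ_two, Prod.forall,
    Fin.forall_fin_two, Matrix.kroneckerMap_apply] at ez ex er
  simp at ez ex er
  obtain ⟨⟨⟨z1, z2, z3⟩, ⟨z4, -⟩, -, z5⟩, ⟨⟨z6, -⟩, -, z7⟩, ⟨z8, z9⟩, z10⟩ := ez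
  have x1 := ex.1.1.2.2
  have x2 := ex.1.2.1.2
  have x3 := ex.1.2.2.1
  have y1 := (mul_eq_zero.mp (by linear_combination z1 : M (0, 0) (0, 1) * (1 - Complex.I) = 0)
    ).resolve_right h1
  have y2 := (mul_eq_zero.mp (by linear_combination z2 : M (0, 0) (1, 0) * (1 - Complex.I) = 0)
    ).resolve_right h1
  have y3 : M (0, 0) (1, 1) = 0 := by linear_combination z3 / 2
  have y4 := (mul_eq_zero.mp (by linear_combination -z4 : M (0, 1) (0, 0) * (1 - Complex.I) = 0)
    ).resolve_right h1
  have y5 := (mul_eq_zero.mp (by linear_combination z5 : M (0, 1) (1, 1) * (1 + Complex.I) = 0)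
    ).resolve_right h2
  have y6 := (mul_eq_zero.mp (by linear_combination -z6 : M (1, 0) (0, 0) * (1 - Complex.I) = 0)
    ).resolve_right h1
  have y7 := (mul_eq_zero.mp (by linear_combination z7 : M (1, 0) (1, 1) * (1 + Complex.I) = 0)
    ).resolve_right h2
  have y8 : M (1, 1) (0, 0) = 0 := by linear_combination -z8 / 2
  have y9 := (mul_eq_zero.mp (by linear_combination -z9 : M (1, 1) (0, 1) * (1 + Complex.I) = 0)
    ).resolve_right h2
  have y10 := (mul_eq_zero.mp (by linear_combination -z10 :
    M (1, 1) (1, 0) * (1 + Complex.I) = 0)).resolve_right h2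
  rw [y1, y2, y3, y9, x2] at er
  have er' : M (0, 0) (0, 0) = M (0, 1) (0, 1) + M (0, 1) (1, 0) := by
    linear_combination -25 / 12 * er
  ext ⟨a, a'⟩ ⟨b, b'⟩
  fin_cases a <;> fin_cases a' <;> fin_cases b <;> fin_cases b' <;>
    simp [swapOp, y1, y2, y3, y4, y5, y6, y7, y8, y9, y10, x1, x2, x3, er']

/-- Cyclicity of the trace lets `V ⊗ V` cancel inside the integral. With `A = 1` and `A = swapOp`
this supplies the two equations that determine a twirl. -/
theorem integral_trace_mul (A O : Matrix (Fin 2 × Fin 2) (Fin 2 × Fin 2) ℂ)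
    (hA : ∀ V : U2, A * (V.1 ⊗ₖ V.1) = (V.1 ⊗ₖ V.1) * A) :
    (A * twirl haarU2 O).trace = (A * O).trace := by
  have hb : ∀ a b, BddMeas fun V : U2 => conj (V.1 ⊗ₖ V.1) O a b :=
    bddMeas_conj_kronecker bddMeas_entry O
  have h : ∀ V : U2, (A * conj (V.1 ⊗ₖ V.1) O).trace = (A * O).trace := fun V => by
    rw [conj, ← Matrix.mul_assoc, ← Matrix.mul_assoc, hA, Matrix.trace_mul_comm,
      ← Matrix.mul_assoc, ← Matrix.mul_assoc, (kronecker_self_mem_unitary V).1, Matrix.one_mul]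
  have h2 : ∫ V : U2, (A * conj (V.1 ⊗ₖ V.1) O).trace ∂haarU2 = (A * twirl haarU2 O).trace := by
    simp only [Matrix.trace, Matrix.diag_apply, Matrix.mul_apply]
    rw [integral_sum_of_bddMeas (f := fun a (V : U2) => ∑ b, A a b * conj (V.1 ⊗ₖ V.1) O b a) _ _
      fun a => BddMeas.sum _ fun b _ => (BddMeas.const _).mul (hb _ _)]
    refine Finset.sum_congr rfl fun a _ => ?_
    rw [integral_sum_of_bddMeas (f := fun b (V : U2) => A a b * conj (V.1 ⊗ₖ V.1) O b a) _ _
      fun b => (BddMeas.const _).mul (hb _ _)]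
    simp_rw [integral_const_mul]
    rfl
  rw [← h2]
  simp_rw [h]
  simp

/-- The Haar twirl of a one-qubit two-copy operator. -/
theorem twirl_haar (O : Matrix (Fin 2 × Fin 2) (Fin 2 × Fin 2) ℂ) :
    twirl haarU2 O = ((4 * O.trace - 2 * (swapOp * O).trace) / 3) • site 0 +
      ((2 * (swapOp * O).trace - O.trace) / 3) • site 1 := by
  have h := eq_one_add_swap_of_commute _ fun W => conj_twirl_haar W O
  have h1 := integral_trace_mul 1 O fun V => by simp
  have h2 := integral_trace_mul swapOp O fun V => swapOp_mul_kronecker _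
  rw [Matrix.one_mul, Matrix.one_mul] at h1
  generalize twirl haarU2 O (0, 1) (0, 1) = x at h
  generalize twirl haarU2 O (0, 1) (1, 0) = y at h
  have hs : swapOp * swapOp = 1 := by
    ext ⟨a, a'⟩ ⟨b, b'⟩
    fin_cases a <;> fin_cases a' <;> fin_cases b <;> fin_cases b' <;>
      simp [swapOp, Matrix.mul_apply, Fintype.sum_prod_type]
  have ht : swapOp.trace = 2 := by
    simp only [swapOp, Matrix.trace, Fintype.sum_prod_type, Matrix.diag_apply, Matrix.of_apply,
      Fin.sum_univ_two]
    norm_num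
  have h4 : (1 : Matrix (Fin 2 × Fin 2) (Fin 2 × Fin 2) ℂ).trace = 4 := by
    simp only [Matrix.trace_one, Fintype.card_prod, Fintype.card_fin]
    norm_num
  rw [h] at h1 h2 ⊢
  rw [Matrix.mul_add, Matrix.mul_smul, Matrix.mul_smul, hs, Matrix.mul_one, Matrix.trace_add,
    Matrix.trace_smul, Matrix.trace_smul, ht, h4, smul_eq_mul, smul_eq_mul] at h2
  rw [Matrix.trace_add, Matrix.trace_smul, Matrix.trace_smul, ht, h4, smul_eq_mul, smul_eq_mul]
    at h1
  -- Here the twirl is `x • 1 + y • swapOp` with `4x + 2y = Tr O` and `2x + 4y = Tr (S O)`; the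
  -- coefficients claimed are `4x` and `2y`.
  rw [← h1, ← h2, site_zero, site_one, smul_smul, smul_smul]
  congr 2 <;> ring

theorem trace_swapOp_mul (O : Matrix (Fin 2 × Fin 2) (Fin 2 × Fin 2) ℂ) :
    (swapOp * O).trace = O (0, 0) (0, 0) + O (0, 1) (1, 0) + O (1, 0) (0, 1) + O (1, 1) (1, 1) := by
  simp [swapOp, Matrix.trace, Matrix.mul_apply, Fintype.sum_prod_type]
  ring

/-- The twirl of two copies of `|0⟩⟨0|`. -/
theorem twirl_haar_init : twirl haarU2 (Matrix.single (0, 0) (0, 0) 1) =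
    (2 / 3 : ℂ) • site 0 + (1 / 3 : ℂ) • site 1 := by
  rw [twirl_haar, trace_swapOp_mul, Matrix.trace_single_eq_same]
  simp
  norm_num

/-! ### The transfer matrix of the feedforward operation -/

/-- The Kraus operators of the feedforward operation. -/
def ffKraus (φ ϕ : ℝ) : Fin 2 → Matrix (Fin 2) (Fin 2) ℂ :=
  ![!![1, 0; 0, 0], ffGate φ ϕ * !![0, 0; 0, 1]]

theorem ffKraus_one (φ ϕ : ℝ) : ffKraus φ ϕ 1 =
    !![0, -(Complex.I * Real.sin φ); 0, Real.cos φ * Complex.exp (Complex.I * ϕ)] := by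
  ext i j
  fin_cases i <;> fin_cases j <;> simp [ffKraus, ffGate]

theorem exp_mul_star (ϕ : ℝ) :
    Complex.exp (Complex.I * ϕ) * star (Complex.exp (Complex.I * ϕ)) = 1 := by
  rw [Complex.star_def, ← Complex.exp_conj, ← Complex.exp_add]
  simp

theorem sum_ffKraus (φ ϕ : ℝ) : ∑ l, (ffKraus φ ϕ l)ᴴ * ffKraus φ ϕ l = 1 := by
  have h := exp_mul_star ϕ
  have h2 : ((Real.sin φ : ℂ)) ^ 2 + (Real.cos φ : ℂ) ^ 2 = 1 := by
    exact_mod_cast Real.sin_sq_add_cos_sq φ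
  rw [Fin.sum_univ_two, ffKraus_one]
  generalize Complex.exp (Complex.I * ϕ) = z at *
  ext i j
  fin_cases i <;> fin_cases j <;>
    simp [ffKraus, Matrix.mul_apply, -Complex.ofReal_sin, -Complex.ofReal_cos]
  simp only [Complex.star_def] at h
  linear_combination h2 + (Real.cos φ : ℂ) ^ 2 * h - (Real.sin φ : ℂ) ^ 2 * Complex.I_sq

/-- The transfer matrix of the feedforward operation. -/
def ffTransfer (φ : ℝ) : Matrix (Fin 2) (Fin 2) ℝ :=
  !![1 - Real.sin φ ^ 2 / 3, 2 / 3; Real.sin φ ^ 2 / 3, 1 / 3]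

/-- By `twirl_haar` only `Tr X` and `Tr (S X)` matter. For the label I, `Tr (S X)` is the purity `(1
+ sin²φ)/2` of the equal mixture of `|0⟩` and `U₁|1⟩`, two states with overlap `sin²φ`; for the
label S it is 1. The S-coefficient `(2 Tr (S X) - Tr X)/3` is then `sin²φ/3` and `1/3`,
respectively. -/
theorem ffTransfer_spec (φ ϕ : ℝ) (e : Fin 2) :
    twirl haarU2 (∑ l, ∑ l', conj (ffKraus φ ϕ l ⊗ₖ ffKraus φ ϕ l') (site e)) =
      ∑ e', (ffTransfer φ e' e : ℂ) • site e' := by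
  have h := exp_mul_star ϕ
  have h2 : ((Real.sin φ : ℂ)) ^ 2 + (Real.cos φ : ℂ) ^ 2 = 1 := by
    exact_mod_cast Real.sin_sq_add_cos_sq φ
  have hk : ∀ a b c d, ∑ l, ffKraus φ ϕ l a c * star (ffKraus φ ϕ l b d) =
      if c = 0 ∧ d = 0 then (if a = 0 ∧ b = 0 then 1 else 0)
      else if c = 1 ∧ d = 1 then
        ffKraus φ ϕ 1 a 1 * star (ffKraus φ ϕ 1 b 1) else 0 := fun a b c d => by
    rw [Fin.sum_univ_two, ffKraus_one]
    fin_cases a <;> fin_cases b <;> fin_cases c <;> fin_cases d <;> simp [ffKraus]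
  have h00 : ffKraus φ ϕ 1 0 1 * star (ffKraus φ ϕ 1 0 1) = (Real.sin φ : ℂ) ^ 2 := by
    rw [ffKraus_one]
    simp [-Complex.ofReal_sin, -Complex.ofReal_cos]
    linear_combination -(Real.sin φ : ℂ) ^ 2 * Complex.I_sq
  have h11 : ffKraus φ ϕ 1 1 1 * star (ffKraus φ ϕ 1 1 1) = (Real.cos φ : ℂ) ^ 2 := by
    rw [ffKraus_one]
    generalize Complex.exp (Complex.I * ϕ) = z at *
    simp [-Complex.ofReal_sin, -Complex.ofReal_cos]
    simp only [Complex.star_def] at h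
    linear_combination (Real.cos φ : ℂ) ^ 2 * h
  have hN : ffKraus φ ϕ 1 0 1 * star (ffKraus φ ϕ 1 0 1) +
      ffKraus φ ϕ 1 1 1 * star (ffKraus φ ϕ 1 1 1) = 1 := by rw [h00, h11, h2]
  set X := ∑ l, ∑ l', conj (ffKraus φ ϕ l ⊗ₖ ffKraus φ ϕ l') (site e) with hX
  have hXe : ∀ a a' b b', X (a, a') (b, b') = ∑ c, ∑ d, ∑ c', ∑ d',
      (∑ l, ffKraus φ ϕ l a c * star (ffKraus φ ϕ l b d)) *
        (∑ l, ffKraus φ ϕ l a' c' * star (ffKraus φ ϕ l b' d')) * site e (c, c') (d, d') :=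
    sum_conj_kronecker _ _
  clear_value X
  simp only [Complex.star_def] at hN h00
  -- `N` is the squared norm of `U₁|1⟩`. The traces below are quadratic in it, such as `(1 + N)²/4`
  -- and `(1 + N²)/2`, so subtracting the target leaves `N - 1` times the cofactors `(N + 3)/4` and
  -- `(N + 1)/2`.
  let N := ffKraus φ ϕ 1 0 1 * starRingEnd ℂ (ffKraus φ ϕ 1 0 1) +
    ffKraus φ ϕ 1 1 1 * starRingEnd ℂ (ffKraus φ ϕ 1 1 1)
  have htr : X.trace = 1 := by
    simp only [Matrix.trace, Matrix.diag_apply, Fintype.sum_prod_type, hXe, hk]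
    fin_cases e <;> simp [site_zero, site_one, swapOp, -Complex.ofReal_sin]
    · linear_combination (N + 3) / 4 * hN
    · linear_combination (N + 1) / 2 * hN
  have hsw : (swapOp * X).trace =
      if e = 0 then (1 + (Real.sin φ : ℂ) ^ 2) / 2 else 1 := by
    rw [trace_swapOp_mul]
    simp only [hXe, hk]
    fin_cases e <;> simp [site_zero, site_one, swapOp, -Complex.ofReal_sin]
    · linear_combination (N + 1) / 4 * hN + h00 / 2
    · linear_combination (N + 1) / 2 * hN
  rw [twirl_haar, htr, hsw, Fin.sum_univ_two]
  congr 2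
  all_goals fin_cases e <;> simp [ffTransfer] <;> ring

/-! ### Second moments after single operations -/

/-- For fixed parameters, integrating over the gate at `q` gives the Haar twirl. Its entry is
required to be the same for every `θ`, so the parameter average is trivial. -/
theorem integral_gates_eq_twirl (D : Measure (Fin p → ℝ)) [IsProbabilityMeasure D]
    {E : Measure U2} (hE : IsTwoDesign E) (q : Place n m)
    {Y : (Fin p → ℝ) → Matrix (Fin 2 × Fin 2) (Fin 2 × Fin 2) ℂ} {a b : Fin 2 × Fin 2} {z : ℂ}
    (hY : BddMeas fun ω : Sample n p m => conj ((ω.2 q).1 ⊗ₖ (ω.2 q).1) (Y ω.1) a b)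
    (hz : ∀ θ, twirl haarU2 (Y θ) a b = z) :
    ∫ ω : Sample n p m, conj ((ω.2 q).1 ⊗ₖ (ω.2 q).1) (Y ω.1) a b
      ∂(D.prod (Measure.pi fun _ => E)) = z := by
  have := hE.1
  rw [integral_prod _ (hY.integrable _)]
  have h : ∀ θ, ∫ V : Place n m → U2, conj ((V q).1 ⊗ₖ (V q).1) (Y θ) a b
      ∂(Measure.pi fun _ => E) = z := by
    intro θ
    rw [← hz, ← hE.2, twirl_eq]
    exact integral_comp_eval (μ := fun _ : Place n m => E) (i := q)
      (f := fun V : U2 => conj (V.1 ⊗ₖ V.1) (Y θ) a b)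
      (bddMeas_conj_kronecker bddMeas_entry _ _ _).1.aestronglyMeasurable
  simp [h]

theorem norm_entry_le_one {κ ι : Type} [Fintype κ] [DecidableEq κ] [Fintype ι]
    {K : ι → Matrix κ κ ℂ} (hK : ∑ l, (K l)ᴴ * K l = 1) (l : ι) (a b : κ) : ‖K l a b‖ ≤ 1 := by
  have h := congrArg Complex.re (congrFun (congrFun hK b) b)
  simp only [Matrix.sum_apply, Matrix.mul_apply, Matrix.conjTranspose_apply, Matrix.one_apply_eq,
    Complex.re_sum, Complex.one_re] at h
  have hn : ∀ l a, (star (K l a b) * K l a b).re = ‖K l a b‖ ^ 2 := fun l a => by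
    rw [Complex.star_def, mul_comm, Complex.mul_conj, Complex.ofReal_re, Complex.normSq_eq_norm_sq]
  simp only [hn] at h
  have h1 : ‖K l a b‖ ^ 2 ≤ 1 := by
    rw [← h]
    refine le_trans (Finset.single_le_sum (f := fun a => ‖K l a b‖ ^ 2)
      (fun a _ => sq_nonneg _) (Finset.mem_univ a)) ?_
    exact Finset.single_le_sum (f := fun l => ∑ a, ‖K l a b‖ ^ 2)
      (fun l _ => Finset.sum_nonneg fun a _ => sq_nonneg _) (Finset.mem_univ l)
  exact (sq_le_one_iff₀ (norm_nonneg _)).mp h1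

/-- A random one-qubit channel followed by a gate of the 2-design. -/
theorem HasMoments.channel1 {owner : Fin p → Fin m} {D : Measure (Fin p → ℝ)}
    [IsProbabilityMeasure D] (hD : BlockIndep owner D) {E : Measure U2} (hE : IsTwoDesign E)
    {F : Sample n p m → Oper n} {S S' : Set (Fin m)} {T : Set (Place n m)} {w : Bits n → ℝ}
    (hF : HasMoments owner D E F S T w) {ι : Type} [Fintype ι] (j : Fin n) {q : Place n m}
    (hq : q ∉ T) {K : (Fin p → ℝ) → ι → Matrix (Fin 2) (Fin 2) ℂ}
    (hK : ∀ l a b, Measurable fun θ => K θ l a b)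
    (hKd : ∀ θ θ', (∀ i, owner i ∈ S' → θ i = θ' i) → K θ = K θ') (hS : Disjoint S S')
    (hK1 : ∀ θ, ∑ l, (K θ l)ᴴ * K θ l = 1) {t : Matrix (Fin 2) (Fin 2) ℝ}
    (ht : ∀ θ e, twirl haarU2 (∑ l, ∑ l', conj (K θ l ⊗ₖ K θ l') (site e)) =
      ∑ e', (t e' e : ℂ) • site e') :
    HasMoments owner D E (fun ω => (region1 j).apply (fun l => (ω.2 q).1 * K ω.1 l) (F ω))
      (S ∪ S') (T ∪ {q}) ((region1 j).push t w) := by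
  have := hE.1
  have hVK1 : ∀ ω : Sample n p m, ∑ l, ((ω.2 q).1 * K ω.1 l)ᴴ * ((ω.2 q).1 * K ω.1 l) = 1 := by
    intro ω
    have h : (ω.2 q).1ᴴ * (ω.2 q).1 = 1 := Matrix.mem_unitaryGroup_iff'.mp (ω.2 q).2
    rw [← hK1 ω.1]
    refine Finset.sum_congr rfl fun l _ => ?_
    rw [Matrix.conjTranspose_mul, Matrix.mul_assoc, ← Matrix.mul_assoc _ᴴ (ω.2 q).1, h,
      Matrix.one_mul]
  have hm : ∀ a b, BddMeas fun ω : Sample n p m => (ω.2 q).1 a b := fun a b =>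
    (bddMeas_entry a b).comp ((measurable_pi_apply q).comp measurable_snd)
  have hKb : ∀ l a b, BddMeas fun ω : Sample n p m => K ω.1 l a b := fun l a b =>
    bddMeas_of_norm_le_one ((hK l a b).comp measurable_fst)
      fun ω => norm_entry_le_one (hK1 ω.1) l a b
  refine hF.apply hD (region1 j) (K := fun ω l => (ω.2 q).1 * K ω.1 l) (fun l a b => ?_)
    (fun ω ω' h1 h2 => ?_) hS (by simpa using hq) hVK1 (fun e a a' b b' => ?_)
  · simp only [Matrix.mul_apply]
    exact BddMeas.sum _ fun c _ => (hm a c).mul (hKb l c b)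
  · simp only [hKd _ _ h1, h2 q rfl]
  · have hsplit : ∀ ω : Sample n p m, (∑ l, ∑ l', conj (((ω.2 q).1 * K ω.1 l) ⊗ₖ
        ((ω.2 q).1 * K ω.1 l')) ((region1 j).localSite e)) =
        conj ((ω.2 q).1 ⊗ₖ (ω.2 q).1) (∑ l, ∑ l', conj (K ω.1 l ⊗ₖ K ω.1 l') (site e)) := by
      intro ω
      simp only [conj_sum, conj_conj, ← Matrix.mul_kronecker_mul]
      rfl
    simp_rw [hsplit]
    refine integral_gates_eq_twirl D hE q
      (Y := fun θ => ∑ l, ∑ l', conj (K θ l ⊗ₖ K θ l') (site e)) ?_ fun θ => ?_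
    · simp only [conj_kronecker_apply, sum_conj_kronecker]
      exact BddMeas.sum _ fun c _ => BddMeas.sum _ fun d _ => BddMeas.sum _ fun c' _ =>
        BddMeas.sum _ fun d' _ => (bddMeas_fourth hm _ _ _ _ _ _ _ _).mul
          (BddMeas.sum _ fun c _ => BddMeas.sum _ fun d _ => BddMeas.sum _ fun c' _ =>
            BddMeas.sum _ fun d' _ =>
              ((BddMeas.sum _ fun l _ => (hKb _ _ _).mul (hKb _ _ _).star).mul
                (BddMeas.sum _ fun l _ => (hKb _ _ _).mul (hKb _ _ _).star)).mul
                (BddMeas.const _))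
    · rw [ht, Matrix.sum_apply]
      rfl

/-- The order `II, IS, SI, SS` of the labels of a pair of qubits. -/
def pairIndex : Fin 2 × Fin 2 ≃ Fin 4 := finProdFinEquiv

/-- The transfer matrix of a two-qubit gate with rows and columns labelled by pairs. -/
def pairTransfer (α β : ℝ) : Matrix (Fin 2 × Fin 2) (Fin 2 × Fin 2) ℝ :=
  (gateTransfer α β).submatrix pairIndex pairIndex

theorem pairBasis_pairIndex (e : Fin 2 × Fin 2) :
    pairBasis (pairIndex e) = pairSite e.1 e.2 := by
  obtain ⟨a, b⟩ := e
  fin_cases a <;> fin_cases b <;> rfl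

theorem dressed_unitary (V : U2 × U2) (U : U4) : (dressed V U)ᴴ * dressed V U = 1 := by
  have h1 : V.1.1ᴴ * V.1.1 = 1 := Matrix.mem_unitaryGroup_iff'.mp V.1.2
  have h2 : V.2.1ᴴ * V.2.1 = 1 := Matrix.mem_unitaryGroup_iff'.mp V.2.2
  have h3 : U.1ᴴ * U.1 = 1 := Matrix.mem_unitaryGroup_iff'.mp U.2
  rw [dressed_apply, Matrix.conjTranspose_mul, Matrix.mul_assoc,
    ← Matrix.mul_assoc (V.1.1 ⊗ₖ V.2.1)ᴴ, Matrix.conjTranspose_kronecker, ← Matrix.mul_kronecker_mul, h1, h2, Matrix.one_kronecker_one,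
    Matrix.one_mul, h3]

theorem map_pair_pi (E : Measure U2) [IsProbabilityMeasure E] {q q' : Place n m} (hqq : q ≠ q') :
    Measure.map (fun V : Place n m → U2 => (V q, V q')) (Measure.pi fun _ => E) = E.prod E := by
  have hpi : iIndepFun (fun (q : Place n m) (V : Place n m → U2) => V q)
      (Measure.pi fun _ => E) :=
    iIndepFun_pi (μ := fun _ : Place n m => E) (X := fun _ V => V) fun _ => aemeasurable_id
  rw [(indepFun_iff_map_prod_eq_prod_map_map (measurable_pi_apply q).aemeasurable
    (measurable_pi_apply q').aemeasurable).mp (hpi.indepFun hqq)]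
  have h := fun q => (measurePreserving_eval (fun _ : Place n m => E) q).map_eq
  exact congrArg₂ Measure.prod (h q) (h q')

/-- A random two-qubit gate followed by gates of the 2-design. -/
theorem HasMoments.gate2 {owner : Fin p → Fin m} {D : Measure (Fin p → ℝ)}
    [IsProbabilityMeasure D] (hD : BlockIndep owner D) {E : Measure U2} (hE : IsTwoDesign E)
    {F : Sample n p m → Oper n} {S S' : Set (Fin m)} {T : Set (Place n m)} {w : Bits n → ℝ}
    (hF : HasMoments owner D E F S T w) {i j : Fin n} (hij : i ≠ j) {q q' : Place n m}
    (hqq : q ≠ q') (hq : q ∉ T) (hq' : q' ∉ T) {U : (Fin p → ℝ) → U4}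
    (hU : ∀ a b, Measurable fun θ => (U θ).1 a b)
    (hUd : ∀ θ θ', (∀ i, owner i ∈ S' → θ i = θ' i) → U θ = U θ') (hS : Disjoint S S')
    {α β : ℝ} (ht : HasGateTransfer D U α β) :
    HasMoments owner D E (fun ω => (region2 i j hij).apply
        (fun _ : Unit => dressed (ω.2 q, ω.2 q') (U ω.1)) (F ω))
      (S ∪ S') (T ∪ {q, q'}) ((region2 i j hij).push (pairTransfer α β) w) := by
  have := hE.1
  have hVm : ∀ q, Measurable fun ω : Sample n p m => ω.2 q := fun q =>
    (measurable_pi_apply q).comp measurable_snd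
  have hdr : ∀ a b, BddMeas fun ω : Sample n p m => dressed (ω.2 q, ω.2 q') (U ω.1) a b := by
    intro a b
    simp only [dressed_apply, Matrix.mul_apply]
    refine BddMeas.sum _ fun c _ => ((bddMeas_kronecker a c).comp
      (u := fun ω : Sample n p m => (ω.2 q, ω.2 q')) ((hVm q).prodMk (hVm q'))).mul ?_
    exact bddMeas_of_norm_le_one ((hU c b).comp measurable_fst)
      fun ω => entry_norm_bound_of_unitary (U ω.1).2 c b
  refine hF.apply hD (region2 i j hij)
    (K := fun ω (_ : Unit) => dressed (ω.2 q, ω.2 q') (U ω.1)) (fun _ a b => hdr a b)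
    (fun ω ω' h1 h2 => ?_) hS ?_ (fun ω => ?_) (fun e a a' b b' => ?_)
  · simp only [hUd _ _ h1, h2 q (Or.inl rfl), h2 q' (Or.inr rfl)]
  · rw [Set.disjoint_right]
    rintro x (rfl | rfl)
    exacts [hq, hq']
  · simpa using dressed_unitary _ _
  · simp only [Finset.univ_unique, Finset.sum_singleton]
    have hb := bddMeas_conj_kronecker hdr ((region2 i j hij).localSite e) (a, a') (b, b')
    rw [integral_prod _ (hb.integrable _)]
    -- Unlike for one-qubit channels, the transfer matrix arises only after averaging over `θ`. For
    -- each `θ` the 2-design pair is replaced by a Haar pair, which gives the integrand of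
    -- `gateAverage`.
    have hin : ∀ θ, ∫ V : Place n m → U2, conj (dressed (V q, V q') (U θ) ⊗ₖ
        dressed (V q, V q') (U θ)) ((region2 i j hij).localSite e) (a, a') (b, b')
          ∂(Measure.pi fun _ => E) =
        ∫ V, conj (dressed V (U θ) ⊗ₖ dressed V (U θ)) (pairBasis (pairIndex e))
          (a, a') (b, b') ∂(haarU2.prod haarU2) := by
      intro θ
      rw [← hE.integral_dressed, ← map_pair_pi (n := n) (m := m) E hqq, integral_map,
        pairBasis_pairIndex]
      · rfl
      · exact ((measurable_pi_apply q).prodMk (measurable_pi_apply q')).aemeasurable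
      · refine (bddMeas_conj_kronecker (fun a b => ?_) _ _ _).1.aestronglyMeasurable
        simp only [dressed_apply, Matrix.mul_apply]
        exact BddMeas.sum _ fun c _ => (bddMeas_kronecker a c).mul (BddMeas.const _)
    simp only [hin]
    have hfin := congrFun (congrFun (ht (pairIndex e)) (a, a')) (b, b')
    rw [Matrix.sum_apply, ← pairIndex.sum_comp] at hfin
    refine Eq.trans hfin (Finset.sum_congr rfl fun e' _ => ?_)
    rw [pairBasis_pairIndex]
    rfl

/-- The distribution on `Bits n` after the initialization. -/
def initWeight (v : Bits n) : ℝ := ∏ i, (![2 / 3, 1 / 3] : Fin 2 → ℝ) (v i)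

theorem conj_single {ι : Type*} [Fintype ι] [DecidableEq ι] (A : Matrix ι ι ℂ) (a b x y : ι) :
    conj A (Matrix.single a b 1) x y = A x a * star (A y b) := by
  rw [conj, Matrix.mul_apply, Finset.sum_eq_single b]
  · simp
  · intro c _ hc
    rw [Matrix.mul_single_apply_of_ne _ _ _ _ _ hc, zero_mul]
  · simp

/-- The initial state with gates of the 2-design inserted. -/
theorem hasMoments_init {owner : Fin p → Fin m} {D : Measure (Fin p → ℝ)}
    [IsProbabilityMeasure D] {E : Measure U2} (hE : IsTwoDesign E) :
    HasMoments owner D E (fun ω => conj (gatesOn Finset.univ fun j : Fin n => ω.2 (Sum.inl j))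
      (Matrix.single 0 0 1)) ∅ (Set.range Sum.inl) initWeight := by
  have := hE.1
  have hentry : ∀ (ω : Sample n p m) x y, conj (gatesOn Finset.univ fun j : Fin n =>
      ω.2 (Sum.inl j)) (Matrix.single 0 0 1) x y =
      ∏ i, ((ω.2 (Sum.inl i)).1 (x i) 0 * star ((ω.2 (Sum.inl i)).1 (y i) 0)) := by
    intro ω x y
    rw [conj_single]
    simp [gatesOn, tensor, Finset.prod_mul_distrib]
  have hVm : ∀ q a b, BddMeas fun ω : Sample n p m => (ω.2 q).1 a b := fun q a b =>
    (bddMeas_entry a b).comp ((measurable_pi_apply q).comp measurable_snd)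
  have hmeas : ∀ x y : Bits n, BddMeas fun ω : Sample n p m => conj (gatesOn Finset.univ
      fun j : Fin n => ω.2 (Sum.inl j)) (Matrix.single 0 0 1) x y := by
    intro x y
    simp only [conj_single, gatesOn, tensor, Matrix.of_apply, Finset.mem_univ, if_true]
    exact (BddMeas.prod _ fun i _ => hVm _ _ _).mul (BddMeas.prod _ fun i _ => hVm _ _ _).star
  refine ⟨hmeas, fun ω ω' _ h => ?_, fun ω => ?_, fun x x' y y' => ?_⟩
  · have : (fun j : Fin n => ω.2 (Sum.inl j)) = fun j => ω'.2 (Sum.inl j) :=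
      funext fun j => h _ ⟨j, rfl⟩
    simp only [this]
  · simp only [Matrix.trace, Matrix.diag_apply, hentry]
    rw [← Fintype.prod_sum fun i a => (ω.2 (Sum.inl i)).1 a 0 * star ((ω.2 (Sum.inl i)).1 a 0)]
    refine Finset.prod_eq_one fun i _ => ?_
    have h : (ω.2 (Sum.inl i)).1ᴴ * (ω.2 (Sum.inl i)).1 = 1 :=
      Matrix.mem_unitaryGroup_iff'.mp (ω.2 (Sum.inl i)).2
    have h00 := congrFun (congrFun h 0) 0
    rw [Matrix.mul_apply] at h00
    simpa [mul_comm] using h00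
  · have hb := (hmeas x y).mul (hmeas x' y')
    rw [integral_prod _ (hb.integrable _)]
    simp only [integral_const, probReal_univ, one_smul]
    -- Places other than the initial ones get the factor 1, so that the integrand is a product over
    -- all places and the product measure factors the integral.
    let g : Place n m → U2 → ℂ := Sum.elim (fun i V => conj (V.1 ⊗ₖ V.1)
      (Matrix.single (0, 0) (0, 0) 1) (x i, x' i) (y i, y' i)) fun _ _ => 1
    have hg : ∀ V : Place n m → U2, conj (gatesOn Finset.univ fun j : Fin n => V (Sum.inl j))
        (Matrix.single 0 0 1) x y * conj (gatesOn Finset.univ fun j : Fin n => V (Sum.inl j))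
        (Matrix.single 0 0 1) x' y' = ∏ q, g q (V q) := by
      intro V
      have h := hentry (0, V)
      simp only at h
      rw [h, h, Fintype.prod_sum_type, ← Finset.prod_mul_distrib]
      simp only [g, Sum.elim_inl, Sum.elim_inr, Finset.prod_const_one, mul_one, conj_single]
      refine Finset.prod_congr rfl fun i _ => ?_
      simp only [Matrix.kroneckerMap_apply, star_mul']
      ring
    simp_rw [hg]
    rw [integral_fintype_prod_eq_prod, Fintype.prod_sum_type]
    simp only [g, Sum.elim_inl, Sum.elim_inr, integral_const, probReal_univ, one_smul,
      Finset.prod_const_one, mul_one, siteWord, initWeight, Complex.ofReal_prod,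
      ← Finset.prod_mul_distrib]
    rw [← Fintype.prod_sum fun i a => (((![2 / 3, 1 / 3] : Fin 2 → ℝ) a : ℝ) : ℂ) *
      site a (x i, x' i) (y i, y' i)]
    refine Finset.prod_congr rfl fun i _ => ?_
    rw [← twirl_eq, hE.2, twirl_haar_init, Fin.sum_univ_two]
    simp

/-! ### Propagation of swap labels -/

/-- The indicator of the label `1`. -/
def bit : Fin 2 → ℝ := ![0, 1]

theorem bit_nonneg (a : Fin 2) : 0 ≤ bit a := by fin_cases a <;> simp [bit]

/-- The weight of the configurations with label `1` on all of `A`. -/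
def tail (w : Bits n → ℝ) (A : Finset (Fin n)) : ℝ := ∑ v, w v * ∏ i ∈ A, bit (v i)

/-- Duality: the transfer matrix acts on weights by columns and on test functions by its transpose,
so a tail after an operation becomes a sum against the weights before it. -/
theorem Region.sum_push {κ : Type} [Fintype κ] [DecidableEq κ] (R : Region n κ)
    (t : Matrix κ κ ℝ) (w g : Bits n → ℝ) :
    ∑ v, R.push t w v * g v = ∑ v, w v * ∑ c, t c (R.get v) * g (R.set c v) := by
  simp only [Region.push, Finset.sum_mul, Finset.mul_sum]
  rw [R.sum_swap]
  refine Finset.sum_congr rfl fun v _ => Finset.sum_congr rfl fun c _ => ?_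
  rw [R.get_set, R.set_set, R.set_get]
  ring

theorem Region.push_nonneg {κ : Type} [Fintype κ] [DecidableEq κ] (R : Region n κ)
    {t : Matrix κ κ ℝ} (ht : ∀ a b, 0 ≤ t a b) {w : Bits n → ℝ} (hw : ∀ v, 0 ≤ w v) (v : Bits n) :
    0 ≤ R.push t w v :=
  Finset.sum_nonneg fun _ _ => mul_nonneg (ht _ _) (hw _)

theorem region1_get (j : Fin n) (v : Bits n) : (region1 j).get v = v j := rfl

theorem region1_set (j : Fin n) (c : Fin 2) (v : Bits n) :
    (region1 j).set c v = Function.update v j c := rfl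

theorem region2_get (i j : Fin n) (hij : i ≠ j) (v : Bits n) :
    (region2 i j hij).get v = (v i, v j) := rfl

theorem region2_set (i j : Fin n) (hij : i ≠ j) (c : Fin 2 × Fin 2) (v : Bits n) :
    (region2 i j hij).set c v = Function.update (Function.update v i c.1) j c.2 := rfl

/-- The lower bound `σ ^ |A| * q ^ ∑ i ∈ A, L i` for the weight of label `1` on `A`, whenever the
elements of `A` are reached at distances `L`. -/
def TailBound (σ q : ℝ) (R : Fin n → ℕ → Prop) (w : Bits n → ℝ) : Prop :=
  ∀ (A : Finset (Fin n)) (L : Fin n → ℕ), (∀ i ∈ A, R i (L i)) →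
    σ ^ A.card * q ^ (∑ i ∈ A, L i) ≤ tail w A

/-- The distances at which qubits are reached, updated by an operation. -/
def reachStep : Op n p → (Fin n → ℕ → Prop) → Fin n → ℕ → Prop
  | .gate1 _ _, R => R
  | .feedforward j, R => fun k l => (k = j ∧ l = 0) ∨ R k l
  | .gate2 i j _ _ _, R => fun k l =>
      ((k = i ∨ k = j) ∧ ∃ r, (r = i ∨ r = j) ∧ ∃ l', l = l' + 1 ∧ R r l') ∨
        (k ≠ i ∧ k ≠ j ∧ R k l)

theorem push_one (j : Fin n) (w : Bits n → ℝ) : (region1 j).push 1 w = w := by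
  ext v
  simp [Region.push, Matrix.one_apply, (region1 j).set_get]

theorem prod_bit_update {A : Finset (Fin n)} {j : Fin n} (hj : j ∉ A) (v : Bits n) (c : Fin 2) :
    ∏ i ∈ A, bit (Function.update v j c i) = ∏ i ∈ A, bit (v i) :=
  Finset.prod_congr rfl fun i hi => by
    rw [Function.update_of_ne (ne_of_mem_of_not_mem hi hj)]

/-- Since every column of `t` gives label 1 at least `σ`, the label of `j` can be forgotten and the
bound for `A.erase j` costs one factor `σ`. Hence `j` restarts at distance 0, and an older distance
for `j` is also admissible because `q ^ L j ≤ 1`. -/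
theorem TailBound.feedforward {σ q : ℝ} (hσ : 0 ≤ σ) (hq0 : 0 ≤ q) (hq1 : q ≤ 1)
    {R : Fin n → ℕ → Prop} {w : Bits n → ℝ} (hw : ∀ v, 0 ≤ w v) (h : TailBound σ q R w)
    (j : Fin n) {t : Matrix (Fin 2) (Fin 2) ℝ} (ht : ∀ b, ∑ a, t a b = 1) (htσ : ∀ b, σ ≤ t 1 b) :
    TailBound σ q (reachStep (p := p) (.feedforward j) R) ((region1 j).push t w) := by
  intro A L hA
  have hA' : ∀ i ∈ A, i ≠ j → R i (L i) := fun i hi hij => (hA i hi).resolve_left fun h => hij h.1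
  rw [tail, Region.sum_push]
  by_cases hj : j ∈ A
  · have hb := h (A.erase j) L fun i hi =>
      hA' i (Finset.mem_of_mem_erase hi) (Finset.ne_of_mem_erase hi)
    have h1 : σ * tail w (A.erase j) ≤ ∑ v, w v * ∑ c, t c ((region1 j).get v) *
        ∏ i ∈ A, bit ((region1 j).set c v i) := by
      rw [tail, Finset.mul_sum]
      refine Finset.sum_le_sum fun v _ => ?_
      simp only [← Finset.mul_prod_erase _ _ hj, region1_get, region1_set,
        prod_bit_update (Finset.notMem_erase j A), Function.update_self, Fin.sum_univ_two]
      have hp : 0 ≤ ∏ i ∈ A.erase j, bit (v i) := Finset.prod_nonneg fun i _ => bit_nonneg _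
      have := mul_le_mul_of_nonneg_right (htσ (v j)) (mul_nonneg (hw v) hp)
      simp only [bit, Matrix.cons_val_zero, Matrix.cons_val_one] at this ⊢
      linarith
    refine le_trans ?_ h1
    rw [← Finset.card_erase_add_one hj, ← Finset.add_sum_erase _ _ hj, pow_succ, pow_add]
    have h2 : σ ^ (A.erase j).card * σ * (q ^ L j * q ^ ∑ i ∈ A.erase j, L i) =
      q ^ L j * (σ * (σ ^ (A.erase j).card * q ^ ∑ i ∈ A.erase j, L i)) := by ring
    rw [h2]
    refine le_trans (mul_le_of_le_one_left (by positivity) (pow_le_one₀ hq0 hq1)) ?_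
    exact mul_le_mul_of_nonneg_left hb hσ
  · refine le_trans (h A L fun i hi => hA' i hi fun hij => hj (hij ▸ hi)) (le_of_eq ?_)
    refine Finset.sum_congr rfl fun v _ => ?_
    simp only [region1_set, prod_bit_update hj, ← Finset.sum_mul, ht, one_mul]

/-- The noisy two-qubit transfer, acting on functions of the labels after the operation. -/
def pairAdjoint (α β γ δ : ℝ) (h : Fin 2 × Fin 2 → ℝ) (c : Fin 2 × Fin 2) : ℝ :=
  ∑ c', pairTransfer α β c' c *
    ∑ a, noiseTransfer γ δ a c'.1 * ∑ b, noiseTransfer γ δ b c'.2 * h (a, b)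

theorem sum_push_gate2 {i j : Fin n} (hij : i ≠ j) (α β γ δ : ℝ) (w : Bits n → ℝ)
    (h : Fin 2 × Fin 2 → ℝ) {A : Finset (Fin n)} (hi : i ∉ A) (hj : j ∉ A) :
    ∑ v, (region1 j).push (noiseTransfer γ δ) ((region1 i).push (noiseTransfer γ δ)
      ((region2 i j hij).push (pairTransfer α β) w)) v * (h (v i, v j) * ∏ l ∈ A, bit (v l)) =
    ∑ v, w v * (pairAdjoint α β γ δ h (v i, v j) * ∏ l ∈ A, bit (v l)) := by
  rw [Region.sum_push, Region.sum_push, Region.sum_push]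
  refine Finset.sum_congr rfl fun v _ => ?_
  simp only [region1_get, region1_set, region2_get, region2_set, prod_bit_update hi,
    prod_bit_update hj, Function.update_self, Function.update_of_ne hij,
    Function.update_of_ne hij.symm, pairAdjoint, ← mul_assoc, ← Finset.sum_mul]

theorem pairIndex_zero_zero : pairIndex (0, 0) = 0 := rfl
theorem pairIndex_zero_one : pairIndex (0, 1) = 1 := rfl
theorem pairIndex_one_zero : pairIndex (1, 0) = 2 := rfl
theorem pairIndex_one_one : pairIndex (1, 1) = 3 := rfl

theorem pairAdjoint_one (α β γ δ : ℝ) (c : Fin 2 × Fin 2) :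
    pairAdjoint α β γ δ (fun _ => 1) c = 1 := by
  obtain ⟨a, b⟩ := c
  fin_cases a <;> fin_cases b <;>
    simp [pairAdjoint, Fintype.sum_prod_type, pairTransfer, pairIndex_zero_zero,
      pairIndex_zero_one, pairIndex_one_zero, pairIndex_one_one, gateTransfer, noiseTransfer] <;>
    ring

/-- If the gate leaves label S on the first qubit with weight `s`, then after noise the weight is `s
(1-γ) + (1-s) δ = δ + s (1-γ-δ)`. For the inputs IS and SI, `s` is `α/5` plus `β` or `1-α-β`, hence
at least `α/5` for every admissible `β`; for SS, `s = 1`. -/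
theorem pairAdjoint_left {α β γ δ : ℝ} (hα : 0 ≤ α) (hβ : 0 ≤ β) (hαβ : β ≤ 1 - α) (hδ : 0 ≤ δ)
    (hγδ : γ + δ ≤ 1) (c : Fin 2 × Fin 2) :
    (α / 5 * (1 - γ - δ) + δ) * bit c.1 ≤ pairAdjoint α β γ δ (fun c => bit c.1) c ∧
    (α / 5 * (1 - γ - δ) + δ) * bit c.2 ≤ pairAdjoint α β γ δ (fun c => bit c.1) c := by
  have h1 : 0 ≤ α * (1 - γ - δ) := mul_nonneg hα (by linarith)
  have h2 : 0 ≤ β * (1 - γ - δ) := mul_nonneg hβ (by linarith)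
  have h3 : 0 ≤ (1 - α - β) * (1 - γ - δ) := mul_nonneg (by linarith) (by linarith)
  obtain ⟨a, b⟩ := c
  fin_cases a <;> fin_cases b <;>
    simp [pairAdjoint, Fintype.sum_prod_type, pairTransfer, pairIndex_zero_zero,
      pairIndex_zero_one, pairIndex_one_zero, pairIndex_one_one, gateTransfer, noiseTransfer,
      bit] <;> (try constructor) <;> nlinarith

theorem pairAdjoint_right {α β γ δ : ℝ} (hα : 0 ≤ α) (hβ : 0 ≤ β) (hαβ : β ≤ 1 - α) (hδ : 0 ≤ δ)
    (hγδ : γ + δ ≤ 1) (c : Fin 2 × Fin 2) :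
    (α / 5 * (1 - γ - δ) + δ) * bit c.1 ≤ pairAdjoint α β γ δ (fun c => bit c.2) c ∧
    (α / 5 * (1 - γ - δ) + δ) * bit c.2 ≤ pairAdjoint α β γ δ (fun c => bit c.2) c := by
  have h1 : 0 ≤ α * (1 - γ - δ) := mul_nonneg hα (by linarith)
  have h2 : 0 ≤ β * (1 - γ - δ) := mul_nonneg hβ (by linarith)
  have h3 : 0 ≤ (1 - α - β) * (1 - γ - δ) := mul_nonneg (by linarith) (by linarith)
  obtain ⟨a, b⟩ := c
  fin_cases a <;> fin_cases b <;>
    simp [pairAdjoint, Fintype.sum_prod_type, pairTransfer, pairIndex_zero_zero,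
      pairIndex_zero_one, pairIndex_one_zero, pairIndex_one_one, gateTransfer, noiseTransfer,
      bit] <;> (try constructor) <;> nlinarith

/-- For the inputs IS and SI, the gate outputs SS with weight `α/5`, exactly one S with weight
`1-α`, and II with weight `4α/5`; the noise then produces SS with weights `(1-γ)²`, `(1-γ)δ` and
`δ²`. The parameter `β` cancels. For the input SS the value is `(1-γ)²`. -/
theorem pairAdjoint_both {α β γ δ : ℝ} (hα : 0 ≤ α) (hα1 : α ≤ 1) (hδ : 0 ≤ δ) (hδγ : δ ≤ γ)
    (hγ : γ ≤ 1 / 2) (c : Fin 2 × Fin 2) :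
    (α / 5 * (1 - γ - δ) + δ) ^ 2 * bit c.1 ≤
      pairAdjoint α β γ δ (fun c => bit c.1 * bit c.2) c ∧
    (α / 5 * (1 - γ - δ) + δ) ^ 2 * bit c.2 ≤
      pairAdjoint α β γ δ (fun c => bit c.1 * bit c.2) c := by
  have h1 : (α / 5 * (1 - γ - δ) + δ) ^ 2 ≤
      α / 5 * (1 - γ) ^ 2 + (1 - α) * (1 - γ) * δ + 4 * α / 5 * δ ^ 2 := by
    -- This product is the right side minus the left side of `h1`. With `a = α/5`, its second factor
    -- is `(a - a²)(1-γ-δ) + (1-5a)δ`, both terms of which are nonnegative because `a ≤ 1/5`.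
    have : 0 ≤ (1 - γ - δ) * ((α / 5 - (α / 5) ^ 2) * (1 - γ) +
        (1 - 6 * (α / 5) + (α / 5) ^ 2) * δ) := by
      refine mul_nonneg (by linarith) ?_
      have h2 : 0 ≤ (α / 5 - (α / 5) ^ 2) * (1 - γ - δ) :=
        mul_nonneg (by nlinarith) (by linarith)
      have h3 : 0 ≤ (1 - 5 * (α / 5)) * δ := mul_nonneg (by linarith) hδ
      linarith
    linarith
  have h2 : (α / 5 * (1 - γ - δ) + δ) ^ 2 ≤ (1 - γ) ^ 2 := by
    have : α / 5 * (1 - γ - δ) ≤ 1 * (1 - γ - δ) :=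
      mul_le_mul_of_nonneg_right (by linarith) (by linarith)
    have h0 : 0 ≤ α / 5 * (1 - γ - δ) := mul_nonneg (by linarith) (by linarith)
    exact pow_le_pow_left₀ (by linarith) (by linarith) 2
  obtain ⟨a, b⟩ := c
  fin_cases a <;> fin_cases b <;>
    simp [pairAdjoint, Fintype.sum_prod_type, pairTransfer, pairIndex_zero_zero,
      pairIndex_zero_one, pairIndex_one_zero, pairIndex_one_one, gateTransfer, noiseTransfer,
      bit] <;> (try constructor) <;> nlinarith

/-- The weights after a noisy two-qubit gate. -/
def gate2Push {i j : Fin n} (hij : i ≠ j) (α β γ δ : ℝ) (w : Bits n → ℝ) : Bits n → ℝ :=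
  (region1 j).push (noiseTransfer γ δ) ((region1 i).push (noiseTransfer γ δ)
    ((region2 i j hij).push (pairTransfer α β) w))

/-- One argument for all ways in which `A` can meet the pair: `g` is the part of the test function
on the pair, and `B` is the part of `A` off the pair. The hypothesis `hg` replaces `g` by `z` times
the label of one incoming qubit `r`, so the old bound applies to `insert r B`. -/
theorem TailBound.le_sum_gate2Push {σ q : ℝ} {R : Fin n → ℕ → Prop} {w : Bits n → ℝ}
    (hw : ∀ v, 0 ≤ w v) (h : TailBound σ q R w) {i j : Fin n} (hij : i ≠ j) {α β γ δ : ℝ}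
    {g : Fin 2 × Fin 2 → ℝ} {z : ℝ} (hz : 0 ≤ z)
    (hg : ∀ c, z * bit c.1 ≤ pairAdjoint α β γ δ g c ∧ z * bit c.2 ≤ pairAdjoint α β γ δ g c)
    {B : Finset (Fin n)} (hi : i ∉ B) (hj : j ∉ B) {L : Fin n → ℕ} (hL : ∀ k ∈ B, R k (L k))
    {r : Fin n} (hr : r = i ∨ r = j) {l : ℕ} (hl : R r l) :
    z * (σ ^ (B.card + 1) * q ^ (l + ∑ k ∈ B, L k)) ≤
      ∑ v, gate2Push hij α β γ δ w v * (g (v i, v j) * ∏ k ∈ B, bit (v k)) := by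
  have hrB : r ∉ B := by rcases hr with rfl | rfl <;> assumption
  have hb := h (insert r B) (Function.update L r l) fun k hk => by
    rcases Finset.mem_insert.mp hk with rfl | hk
    · simpa using hl
    · rw [Function.update_of_ne (ne_of_mem_of_not_mem hk hrB)]
      exact hL k hk
  rw [Finset.card_insert_of_notMem hrB, Finset.sum_insert hrB, Function.update_self,
    Finset.sum_congr rfl fun k hk => by
      rw [Function.update_of_ne (ne_of_mem_of_not_mem hk hrB)]] at hb
  refine (mul_le_mul_of_nonneg_left hb hz).trans ?_
  rw [gate2Push, sum_push_gate2 hij _ _ _ _ _ _ hi hj, tail, Finset.mul_sum]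
  refine Finset.sum_le_sum fun v _ => ?_
  have hp : 0 ≤ w v * ∏ k ∈ B, bit (v k) :=
    mul_nonneg (hw v) (Finset.prod_nonneg fun i _ => bit_nonneg _)
  have hc : z * bit (v r) ≤ pairAdjoint α β γ δ g (v i, v j) := by
    rcases hr with rfl | rfl
    exacts [(hg (v r, v j)).1, (hg (v i, v r)).2]
  rw [Finset.prod_insert hrB]
  have := mul_le_mul_of_nonneg_right hc hp
  linarith

/-- The cases are those of `A` meeting the pair in two, one or no qubits. One qubit costs a factor
`q`, which is the increment of its distance. If `A` misses the pair, the pair is summed out with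
total weight 1. -/
theorem TailBound.gate2 {σ : ℝ} (hσ0 : 0 ≤ σ) (hσ1 : σ ≤ 1) {α β γ δ : ℝ}
    (hα : 0 ≤ α) (hα1 : α ≤ 1) (hβ : 0 ≤ β) (hαβ : β ≤ 1 - α) (hδ : 0 ≤ δ) (hδγ : δ ≤ γ)
    (hγ : γ ≤ 1 / 2) {R : Fin n → ℕ → Prop} {w : Bits n → ℝ} (hw : ∀ v, 0 ≤ w v)
    (h : TailBound σ (α / 5 * (1 - γ - δ) + δ) R w) {i j : Fin n} (hij : i ≠ j)
    (U : (Fin p → ℝ) → U4) (Ni Nj : QubitChannel) :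
    TailBound σ (α / 5 * (1 - γ - δ) + δ) (reachStep (.gate2 i j U Ni Nj) R)
      (gate2Push hij α β γ δ w) := by
  have hγδ : γ + δ ≤ 1 := by linarith
  set q := α / 5 * (1 - γ - δ) + δ with hq
  have hq0 : 0 ≤ q := by
    have : 0 ≤ α / 5 * (1 - γ - δ) := mul_nonneg (by linarith) (by linarith)
    linarith
  have hq1 : q ≤ 1 := by
    have : α / 5 * (1 - γ - δ) ≤ 1 * (1 - γ - δ) :=
      mul_le_mul_of_nonneg_right (by linarith) (by linarith)
    linarith
  intro A L hA
  have hout : ∀ k ∈ A, k ≠ i → k ≠ j → R k (L k) := fun k hk hki hkj => by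
    rcases hA k hk with ⟨h1, -⟩ | ⟨-, -, h1⟩
    · exact absurd h1 (by simp [hki, hkj])
    · exact h1
  have hin : ∀ k ∈ A, (k = i ∨ k = j) → ∃ r, (r = i ∨ r = j) ∧ ∃ l', L k = l' + 1 ∧ R r l' :=
    fun k hk hk' => by
      rcases hA k hk with ⟨-, h1⟩ | ⟨h1, h2, -⟩
      · exact h1
      · exact absurd hk' (by simp [h1, h2])
  set B := (A.erase i).erase j with hB
  have hiB : i ∉ B := fun hi => Finset.notMem_erase i A (Finset.mem_of_mem_erase hi)
  have hjB : j ∉ B := Finset.notMem_erase j _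
  have hBL : ∀ k ∈ B, R k (L k) := fun k hk =>
    hout k (Finset.mem_of_mem_erase (Finset.mem_of_mem_erase hk))
      (ne_of_mem_of_not_mem hk hiB) (ne_of_mem_of_not_mem hk hjB)
  by_cases hi : i ∈ A <;> by_cases hj : j ∈ A
  · have hj' : j ∈ A.erase i := Finset.mem_erase.mpr ⟨hij.symm, hj⟩
    obtain ⟨r, hr, l, hl, hRl⟩ := hin i hi (Or.inl rfl)
    -- Only the predecessor `r` of `i` is followed; the two predecessors may coincide. The factor
    -- `q²` pays both increments, and the surplus `σ * q ^ l'` belonging to `j` is at most 1 and is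
    -- dropped.
    obtain ⟨-, -, l', hl', -⟩ := hin j hj (Or.inr rfl)
    have key := h.le_sum_gate2Push hw hij (sq_nonneg q) (pairAdjoint_both hα hα1 hδ hδγ hγ
      (β := β)) hiB hjB hBL hr hRl
    have ht : tail (gate2Push hij α β γ δ w) A = ∑ v, gate2Push hij α β γ δ w v *
        (bit (v i) * bit (v j) * ∏ k ∈ B, bit (v k)) :=
      Finset.sum_congr rfl fun v _ => by
        rw [← Finset.mul_prod_erase _ _ hi, ← Finset.mul_prod_erase _ _ hj', ← hB]
        ring
    rw [ht]
    refine le_trans ?_ key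
    rw [← Finset.card_erase_add_one hi, ← Finset.card_erase_add_one hj',
      ← Finset.add_sum_erase _ _ hi, ← Finset.add_sum_erase _ _ hj', hl, hl', ← hB]
    have h1 : σ ^ (B.card + 1 + 1) * q ^ (l + 1 + (l' + 1 + ∑ x ∈ B, L x)) =
        (σ * q ^ l') * (q ^ 2 * (σ ^ (B.card + 1) * q ^ (l + ∑ k ∈ B, L k))) := by ring
    rw [h1]
    exact mul_le_of_le_one_left (by positivity)
      (mul_le_one₀ hσ1 (by positivity) (pow_le_one₀ hq0 hq1))
  · have hB' : B = A.erase i := Finset.erase_eq_of_notMem fun h => hj (Finset.mem_of_mem_erase h)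
    obtain ⟨r, hr, l, hl, hRl⟩ := hin i hi (Or.inl rfl)
    have key := h.le_sum_gate2Push hw hij hq0 (pairAdjoint_left hα hβ hαβ hδ hγδ)
      hiB hjB hBL hr hRl
    have ht : tail (gate2Push hij α β γ δ w) A = ∑ v, gate2Push hij α β γ δ w v *
        (bit (v i) * ∏ k ∈ B, bit (v k)) :=
      Finset.sum_congr rfl fun v _ => by rw [hB', ← Finset.mul_prod_erase _ _ hi]
    rw [ht]
    refine le_trans (le_of_eq ?_) key
    rw [← Finset.card_erase_add_one hi, ← Finset.add_sum_erase _ _ hi, hl, ← hB']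
    ring
  · have hB' : B = A.erase j := by rw [hB, Finset.erase_eq_of_notMem hi]
    obtain ⟨r, hr, l, hl, hRl⟩ := hin j hj (Or.inr rfl)
    have key := h.le_sum_gate2Push hw hij hq0 (pairAdjoint_right hα hβ hαβ hδ hγδ)
      hiB hjB hBL hr hRl
    have ht : tail (gate2Push hij α β γ δ w) A = ∑ v, gate2Push hij α β γ δ w v *
        (bit (v j) * ∏ k ∈ B, bit (v k)) :=
      Finset.sum_congr rfl fun v _ => by rw [hB', ← Finset.mul_prod_erase _ _ hj]
    rw [ht]
    refine le_trans (le_of_eq ?_) key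
    rw [← Finset.card_erase_add_one hj, ← Finset.add_sum_erase _ _ hj, hl, ← hB']
    ring
  · have hB' : B = A := by
      rw [hB, Finset.erase_eq_of_notMem hi, Finset.erase_eq_of_notMem hj]
    refine le_trans (h A L fun k hk => hout k hk (ne_of_mem_of_not_mem hk hi)
      (ne_of_mem_of_not_mem hk hj)) (le_of_eq ?_)
    have := sum_push_gate2 hij α β γ δ w (fun _ => 1) hi hj
    simp only [pairAdjoint_one, one_mul] at this
    exact this.symm

theorem noiseTransfer_nonneg {γ δ : ℝ} (hδ : 0 ≤ δ) (hδγ : δ ≤ γ) (hγ : γ ≤ 1 / 2) (a b : Fin 2) :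
    0 ≤ noiseTransfer γ δ a b := by
  fin_cases a <;> fin_cases b <;> simp [noiseTransfer] <;> linarith

theorem pairTransfer_nonneg {α β : ℝ} (hα : 0 ≤ α) (hβ : 0 ≤ β) (hαβ : β ≤ 1 - α)
    (a b : Fin 2 × Fin 2) : 0 ≤ pairTransfer α β a b := by
  obtain ⟨a, a'⟩ := a
  obtain ⟨b, b'⟩ := b
  fin_cases a <;> fin_cases a' <;> fin_cases b <;> fin_cases b' <;>
    simp [pairTransfer, pairIndex_zero_zero, pairIndex_zero_one, pairIndex_one_zero,
      pairIndex_one_one, gateTransfer] <;> linarith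

theorem gate2Push_nonneg {i j : Fin n} (hij : i ≠ j) {α β γ δ : ℝ} (hα : 0 ≤ α) (hβ : 0 ≤ β)
    (hαβ : β ≤ 1 - α) (hδ : 0 ≤ δ) (hδγ : δ ≤ γ) (hγ : γ ≤ 1 / 2) {w : Bits n → ℝ}
    (hw : ∀ v, 0 ≤ w v) (v : Bits n) : 0 ≤ gate2Push hij α β γ δ w v :=
  Region.push_nonneg _ (noiseTransfer_nonneg hδ hδγ hγ)
    (Region.push_nonneg _ (noiseTransfer_nonneg hδ hδγ hγ)
      (Region.push_nonneg _ (pairTransfer_nonneg hα hβ hαβ) hw)) v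

theorem ffTransfer_nonneg (φ : ℝ) (a b : Fin 2) : 0 ≤ ffTransfer φ a b := by
  have h := Real.sin_sq_le_one φ
  have h' := sq_nonneg (Real.sin φ)
  fin_cases a <;> fin_cases b <;> simp [ffTransfer] <;> nlinarith

theorem ffTransfer_sum (φ : ℝ) (b : Fin 2) : ∑ a, ffTransfer φ a b = 1 := by
  fin_cases b <;> simp [ffTransfer]
  norm_num

theorem ffTransfer_ge (φ : ℝ) (b : Fin 2) : Real.sin φ ^ 2 / 3 ≤ ffTransfer φ 1 b := by
  have h := Real.sin_sq_le_one φ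
  fin_cases b <;> simp [ffTransfer]
  linarith

theorem initWeight_nonneg (v : Bits n) : 0 ≤ initWeight v :=
  Finset.prod_nonneg fun i _ => by
    generalize v i = a
    fin_cases a <;> norm_num

theorem sum_initWeight : ∑ v : Bits n, initWeight v = 1 := by
  simp only [initWeight]
  rw [← Fintype.prod_sum fun (_ : Fin n) a => (![2 / 3, 1 / 3] : Fin 2 → ℝ) a]
  refine Finset.prod_eq_one fun i _ => ?_
  rw [Fin.sum_univ_two]
  norm_num

theorem tailBound_init (σ q : ℝ) : TailBound σ q (fun (_ : Fin n) _ => False) initWeight := by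
  intro A L hA
  have : A = ∅ := Finset.eq_empty_of_forall_notMem hA
  subst this
  simp [tail, sum_initWeight]

/-! ### Induction over the operations of a circuit -/

theorem twirl_haar_site (e : Fin 2) : twirl haarU2 (site e) = site e := by
  ext a b
  rw [twirl_eq]
  simp_rw [conj_site]
  simp

theorem runInserted_gate1 (φ ϕ : ℝ) (θ : Fin p → ℝ) (V V' : Fin n → U2) (j : Fin n)
    (U : (Fin p → ℝ) → U2) (ρ : Oper n) :
    (Op.gate1 j U).runInserted φ ϕ θ V V' ρ =
      (region1 j).apply (fun _ : Unit => (V j).1 * (U θ).1) ρ := by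
  rw [← Region.sum_conj_eq_apply (M := fun _ => gatesOn {j} V * embed1 j (U θ).1)
    fun _ => (gatesOn_singleton_isLift j V).mul (embed1_isLift j _)]
  simp [Op.runInserted, conj_conj]

theorem runInserted_feedforward (φ ϕ : ℝ) (θ : Fin p → ℝ) (V V' : Fin n → U2) (j : Fin n)
    (ρ : Oper n) : (Op.feedforward j : Op n p).runInserted φ ϕ θ V V' ρ =
      (region1 j).apply (fun l => (V j).1 * ffKraus φ ϕ l) ρ := by
  rw [← Region.sum_conj_eq_apply (M := fun l => gatesOn {j} V * embed1 j (ffKraus φ ϕ l))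
    fun _ => (gatesOn_singleton_isLift j V).mul (embed1_isLift j _)]
  simp only [← conj_conj, ← conj_sum, Fin.sum_univ_two]
  rfl

/-- Operators on different qubits commute, so the gates inserted after both noise channels can be
regrouped, each next to its own channel. Each noise channel then becomes a one-qubit step followed
by a twirl. -/
theorem gatesOn_pair_mul (i j : Fin n) (hij : i ≠ j) (V : Fin n → U2)
    (A B : Matrix (Fin 2) (Fin 2) ℂ) :
    gatesOn {i, j} V * (embed1 j B * embed1 i A) =
      (gatesOn {j} V * embed1 j B) * (gatesOn {i} V * embed1 i A) := by
  simp only [gatesOn, embed1, tensor_mul]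
  congr 1
  funext k
  by_cases hi : k = i
  · subst hi; simp [hij]
  · by_cases hj : k = j
    · subst hj; simp [hi]
    · simp [hi, hj]

theorem runInserted_gate2 (φ ϕ : ℝ) (θ : Fin p → ℝ) (V V' : Fin n → U2) {i j : Fin n}
    (hij : i ≠ j) (U : (Fin p → ℝ) → U4) (Ni Nj : QubitChannel) (ρ : Oper n) :
    (Op.gate2 i j U Ni Nj).runInserted φ ϕ θ V V' ρ =
      (region1 j).apply (fun l => (V' j).1 * Nj.kraus l)
        ((region1 i).apply (fun l => (V' i).1 * Ni.kraus l)
          ((region2 i j hij).apply (fun _ : Unit => dressed (V i, V j) (U θ)) ρ)) := by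
  rw [← Region.sum_conj_eq_apply (M := fun _ => gatesOn {i, j} V * embed2 i j (U θ).1)
      (K := fun _ : Unit => dressed (V i, V j) (U θ))
      fun _ => (gatesOn_pair_isLift i j hij V).mul (embed2_isLift i j hij _),
    ← Region.sum_conj_eq_apply (M := fun l => gatesOn {i} V' * embed1 i (Ni.kraus l))
      fun _ => (gatesOn_singleton_isLift i V').mul (embed1_isLift i _),
    ← Region.sum_conj_eq_apply (M := fun l => gatesOn {j} V' * embed1 j (Nj.kraus l))
      fun _ => (gatesOn_singleton_isLift j V').mul (embed1_isLift j _)]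
  simp only [Op.runInserted, QubitChannel.applyAt, conj_sum, Finset.univ_unique,
    Finset.sum_singleton, conj_conj]
  refine Finset.sum_congr rfl fun l _ => Finset.sum_congr rfl fun l' _ => ?_
  have h := gatesOn_pair_mul i j hij V' (Ni.kraus l') (Nj.kraus l)
  congr 1
  rw [← Matrix.mul_assoc (gatesOn {j} V' * _), ← h]
  simp only [Matrix.mul_assoc]

theorem HasMoments.mono {owner : Fin p → Fin m} {D : Measure (Fin p → ℝ)} {E : Measure U2}
    {F : Sample n p m → Oper n} {S S' : Set (Fin m)} {T T' : Set (Place n m)} {w : Bits n → ℝ}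
    (h : HasMoments owner D E F S T w) (hS : S ⊆ S') (hT : T ⊆ T') :
    HasMoments owner D E F S' T' w :=
  ⟨h.bdd, h.dep.mono hS hT, h.trace, h.moment⟩

/-- The places after the operation `s`. -/
def placesAfter (n : ℕ) (s : Fin m) : Set (Place n m) := {q | ∃ z, q = Sum.inr (s, z)}

theorem HasMoments.op_step {owner : Fin p → Fin m} {D : Measure (Fin p → ℝ)}
    [IsProbabilityMeasure D] (hD : BlockIndep owner D) {E : Measure U2} (hE : IsTwoDesign E)
    {F : Sample n p m → Oper n} {S : Set (Fin m)} {T : Set (Place n m)} {w : Bits n → ℝ}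
    (hF : HasMoments owner D E F S T w) {s : Fin m} (hs : s ∉ S)
    (hsT : ∀ z, Sum.inr (s, z) ∉ T) {o : Op n p} (φ ϕ : ℝ) {α γ δ : ℝ}
    (hmeas : o.GateMeasurable) (hdep : o.DependsOnlyOn {i | owner i = s})
    (hij : ∀ i j U Ni Nj, o = .gate2 i j U Ni Nj → i ≠ j)
    (hα0 : 0 ≤ α) (hα1 : α ≤ 1) (hgate : o.GateTransferCondition D α)
    (hδ0 : 0 ≤ δ) (hδγ : δ ≤ γ) (hγ : γ ≤ 1 / 2) (hnoise : o.NoiseTransferCondition γ δ)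
    (hw : ∀ v, 0 ≤ w v) {R : Fin n → ℕ → Prop}
    (hR : TailBound (Real.sin φ ^ 2 / 3) (α / 5 * (1 - γ - δ) + δ) R w) :
    ∃ w' : Bits n → ℝ, (∀ v, 0 ≤ w' v) ∧
      TailBound (Real.sin φ ^ 2 / 3) (α / 5 * (1 - γ - δ) + δ) (reachStep o R) w' ∧
      HasMoments owner D E (fun ω => o.runInserted φ ϕ ω.1 (fun j => ω.2 (Sum.inr (s, false, j)))
        (fun j => ω.2 (Sum.inr (s, true, j))) (F ω)) (S ∪ {s}) (T ∪ placesAfter n s) w' := by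
  have hσ0 : 0 ≤ Real.sin φ ^ 2 / 3 := by positivity
  have hσ1 : Real.sin φ ^ 2 / 3 ≤ 1 := by linarith [Real.sin_sq_le_one φ]
  have hq0 : 0 ≤ α / 5 * (1 - γ - δ) + δ :=
    add_nonneg (mul_nonneg (by linarith) (by linarith)) hδ0
  have hq1 : α / 5 * (1 - γ - δ) + δ ≤ 1 := by
    have : α / 5 * (1 - γ - δ) ≤ 1 * (1 - γ - δ) :=
      mul_le_mul_of_nonneg_right (by linarith) (by linarith)
    linarith
  have hsS : Disjoint S {s} := Set.disjoint_singleton_right.mpr hs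
  cases o with
  | gate1 j U =>
    refine ⟨w, hw, hR, ?_⟩
    simp only [runInserted_gate1]
    -- A one-qubit unitary leaves both site operators invariant, so its transfer matrix is the
    -- identity for every `θ`.
    have h := hF.channel1 hD hE j (hsT (false, j)) (S' := {s}) (K := fun θ (_ : Unit) => (U θ).1)
      (fun _ a b => hmeas a b) (fun θ θ' h => by rw [hdep θ θ' h]) hsS
      (fun θ => by
        rw [Finset.univ_unique, Finset.sum_singleton]
        exact Matrix.mem_unitaryGroup_iff'.mp (U θ).2) (t := 1) (fun θ e => by
        simp [conj_site, twirl_haar_site, Matrix.one_apply])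
    rw [push_one] at h
    exact h.mono le_rfl (Set.union_subset_union_right _ (by rintro _ rfl; exact ⟨_, rfl⟩))
  | feedforward j =>
    refine ⟨_, (region1 j).push_nonneg (ffTransfer_nonneg φ) hw,
      hR.feedforward hσ0 hq0 hq1 hw j (ffTransfer_sum φ) (ffTransfer_ge φ), ?_⟩
    simp only [runInserted_feedforward]
    have h := hF.channel1 hD hE j (hsT (false, j)) (S' := {s}) (K := fun _ => ffKraus φ ϕ)
      (fun _ a b => measurable_const) (fun θ θ' h => rfl) hsS
      (fun θ => sum_ffKraus φ ϕ) (t := ffTransfer φ) (fun θ e => ffTransfer_spec φ ϕ e)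
    exact h.mono le_rfl (Set.union_subset_union_right _ (by rintro _ rfl; exact ⟨_, rfl⟩))
  | gate2 i j U Ni Nj =>
    have hij := hij i j U Ni Nj rfl
    obtain ⟨β, hβ0, hβ1, hβ⟩ := hgate
    refine ⟨_, gate2Push_nonneg hij hα0 hβ0 hβ1 hδ0 hδγ hγ hw,
      hR.gate2 hσ0 hσ1 hα0 hα1 hβ0 hβ1 hδ0 hδγ hγ hw hij U Ni Nj, ?_⟩
    simp only [runInserted_gate2 _ _ _ _ _ hij]
    have h1 := hF.gate2 hD hE hij (q := Sum.inr (s, false, i)) (q' := Sum.inr (s, false, j))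
      (by simpa using hij) (hsT _) (hsT _) hmeas (S' := {s})
      (fun θ θ' h => hdep θ θ' h) hsS hβ
    -- Noise carries no parameters, so it adds no owner (`S' = ∅`). Its twirling gates sit at the
    -- places marked `true`, which are still unused.
    have h2 := h1.channel1 hD hE i (q := Sum.inr (s, true, i)) (by simp [hsT]) (S' := ∅)
      (K := fun _ => Ni.kraus) (fun _ _ _ => measurable_const) (fun _ _ _ => rfl)
      (Set.disjoint_empty _) (fun _ => Ni.sum_kraus) (t := noiseTransfer γ δ)
      (fun _ e => hnoise.1 e)
    have h3 := h2.channel1 hD hE j (q := Sum.inr (s, true, j))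
      (by simp [hsT, hij.symm]) (S' := ∅)
      (K := fun _ => Nj.kraus) (fun _ _ _ => measurable_const) (fun _ _ _ => rfl)
      (Set.disjoint_empty _) (fun _ => Nj.sum_kraus) (t := noiseTransfer γ δ)
      (fun _ e => hnoise.2 e)
    refine h3.mono (by simp) ?_
    simp only [Set.union_assoc]
    refine Set.union_subset_union_right _ ?_
    rintro x ((rfl | rfl) | rfl | rfl) <;> exact ⟨_, rfl⟩

theorem foldl_eq_of_succ {β : Type*} : ∀ {m : ℕ} (f : β → Fin m → β) (x : β)
    (g : Fin (m + 1) → β), g 0 = x → (∀ s, g s.succ = f (g s.castSucc) s) →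
    Fin.foldl m f x = g (Fin.last m)
  | 0, f, x, g, h0, _ => by simpa using h0.symm
  | m + 1, f, x, g, h0, hs => by
    rw [Fin.foldl_succ_last, foldl_eq_of_succ (fun y s => f y s.castSucc) x
      (fun t => g t.castSucc) h0 fun s => hs s.castSucc]
    exact (hs (Fin.last m)).symm

namespace Circuit

variable (C : Circuit n p d m)

/-- The operator after the operations before `t`, with gates inserted. -/
def stage (φ ϕ : ℝ) (ω : Sample n p m) (ρ : Oper n) : Fin (m + 1) → Oper n :=
  Fin.induction (motive := fun _ => Oper n)
    (conj (gatesOn Finset.univ fun j => ω.2 (Sum.inl j)) ρ)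
    fun s σ => (C.op s).runInserted φ ϕ ω.1
      (fun j => ω.2 (Sum.inr (s, false, j))) (fun j => ω.2 (Sum.inr (s, true, j))) σ

theorem stage_succ (φ ϕ : ℝ) (ω : Sample n p m) (ρ : Oper n) (s : Fin m) :
    C.stage φ ϕ ω ρ s.succ = (C.op s).runInserted φ ϕ ω.1
      (fun j => ω.2 (Sum.inr (s, false, j))) (fun j => ω.2 (Sum.inr (s, true, j)))
      (C.stage φ ϕ ω ρ s.castSucc) := Fin.induction_succ ..

theorem channelInserted_eq_stage (φ ϕ : ℝ) (ω : Sample n p m) (ρ : Oper n) :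
    C.channelInserted φ ϕ ω.1 ω.2 ρ = C.stage φ ϕ ω ρ (Fin.last m) :=
  foldl_eq_of_succ _ _ _ rfl fun s => C.stage_succ φ ϕ ω ρ s

/-- The distances at which qubits are reached by the operations before `t`. -/
def reach : Fin (m + 1) → Fin n → ℕ → Prop :=
  Fin.induction (motive := fun _ => Fin n → ℕ → Prop) (fun _ _ => False)
    fun s R => reachStep (C.op s) R

theorem reach_succ (s : Fin m) : C.reach s.succ = reachStep (C.op s) (C.reach s.castSucc) :=
  Fin.induction_succ ..

/-- The owners and places recorded in the moment statement are those of the past. Each operation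
therefore meets fresh parameters and fresh gates, which is the independence that `op_step` needs. -/
theorem exists_hasMoments {owner : Fin p → Fin m} {D : Measure (Fin p → ℝ)}
    [IsProbabilityMeasure D] (hD : BlockIndep owner D) {E : Measure U2} (hE : IsTwoDesign E)
    (φ ϕ : ℝ) {α γ δ : ℝ} (hmeas : C.GatesMeasurable)
    (hdep : ∀ s, (C.op s).DependsOnlyOn {i | owner i = s})
    (hα0 : 0 ≤ α) (hα1 : α ≤ 1) (hgate : ∀ s, (C.op s).GateTransferCondition D α)
    (hδ0 : 0 ≤ δ) (hδγ : δ ≤ γ) (hγ : γ ≤ 1 / 2)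
    (hnoise : ∀ s, (C.op s).NoiseTransferCondition γ δ) (t : Fin (m + 1)) :
    ∃ w : Bits n → ℝ, (∀ v, 0 ≤ w v) ∧
      TailBound (Real.sin φ ^ 2 / 3) (α / 5 * (1 - γ - δ) + δ) (C.reach t) w ∧
      HasMoments owner D E (fun ω => C.stage φ ϕ ω (Matrix.single 0 0 1) t)
        {s | s.castSucc < t} (Set.range Sum.inl ∪ ⋃ s ∈ {s : Fin m | s.castSucc < t},
          placesAfter n s) w := by
  induction t using Fin.induction with
  | zero =>
    exact ⟨initWeight, initWeight_nonneg, tailBound_init _ _, (hasMoments_init hE).mono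
      (Set.empty_subset _) Set.subset_union_left⟩
  | succ s ih =>
    obtain ⟨w, hw, hR, hF⟩ := ih
    obtain ⟨w', hw', hR', hF'⟩ := hF.op_step hD hE (s := s) (by simp)
      (by simpa [placesAfter] using fun _ _ h => h.ne') (o := C.op s) φ ϕ (hmeas s) (hdep s)
      (fun i j U Ni Nj h => (C.adj s i j U Ni Nj h).ne) hα0 hα1 (hgate s) hδ0 hδγ hγ (hnoise s)
      hw hR
    refine ⟨w', hw', by rwa [reach_succ], ?_⟩
    simp only [stage_succ]
    refine hF'.mono ?_ ?_
    · rintro x (hx | rfl)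
      · exact lt_trans hx (Fin.castSucc_lt_succ)
      · exact Fin.castSucc_lt_succ
    · rintro x ((hx | hx) | hx)
      · exact Or.inl hx
      · obtain ⟨s', hs', hx⟩ := Set.mem_iUnion₂.mp hx
        exact Or.inr (Set.mem_iUnion₂.mpr ⟨s', lt_trans hs' (Fin.castSucc_lt_succ), hx⟩)
      · exact Or.inr (Set.mem_iUnion₂.mpr ⟨s, Fin.castSucc_lt_succ, hx⟩)

end Circuit

/-! ### Feedforward paths -/

namespace Circuit

variable (C : Circuit n p d m)

-- The part of the path up to `t` realizes the recursion `reachStep`: the count of traversed gates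
-- is 0 when the starting operation is completed and grows by one exactly at a two-qubit gate
-- containing both the old and the new position.
open Classical in
theorem FeedforwardPath.reach {C : Circuit n p d m} {j : Fin n} (P : C.FeedforwardPath j)
    (t : Fin (m + 1)) (ht : P.start.castSucc < t) :
    C.reach t (P.loc t) (Finset.univ.filter fun s => s.castSucc < t ∧ P.start < s ∧
      (C.op s).IsTwoQubit ∧ P.loc s.castSucc ∈ (C.op s).supp ∧
      P.loc s.succ ∈ (C.op s).supp).card := by
  induction t using Fin.induction with
  | zero => exact absurd ht (Fin.not_lt_zero _)
  | succ s ih =>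
    rw [reach_succ]
    rcases eq_or_lt_of_le (Fin.castSucc_lt_succ_iff.mp ht) with hs | hs
    · subst hs
      rw [P.start_feedforward]
      refine Or.inl ⟨rfl, Finset.card_eq_zero.mpr (Finset.filter_eq_empty_iff.mpr ?_)⟩
      rintro s - ⟨h1, h2, -⟩
      exact absurd (Fin.castSucc_lt_succ_iff.mp h1) (not_le.mpr h2)
    · have ih := ih (Fin.castSucc_lt_castSucc_iff.mpr hs)
      have hsame : ¬ ((C.op s).IsTwoQubit ∧ P.loc s.castSucc ∈ (C.op s).supp ∧
          P.loc s.succ ∈ (C.op s).supp) →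
          (Finset.univ.filter fun s' : Fin m => s'.castSucc < s.succ ∧ P.start < s' ∧
            (C.op s').IsTwoQubit ∧ P.loc s'.castSucc ∈ (C.op s').supp ∧
            P.loc s'.succ ∈ (C.op s').supp) =
          Finset.univ.filter fun s' : Fin m => s'.castSucc < s.castSucc ∧ P.start < s' ∧
            (C.op s').IsTwoQubit ∧ P.loc s'.castSucc ∈ (C.op s').supp ∧
            P.loc s'.succ ∈ (C.op s').supp := by
        intro hn
        ext s'
        simp only [Finset.mem_filter, Finset.mem_univ, true_and, Fin.castSucc_lt_succ_iff,
          Fin.castSucc_lt_castSucc_iff]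
        refine ⟨fun h => ⟨lt_of_le_of_ne h.1 ?_, h.2⟩, fun h => ⟨h.1.le, h.2⟩⟩
        rintro rfl
        exact hn h.2.2
      have hcon := P.connected s hs
      cases hop : C.op s with
      | gate1 k U =>
        have heq : P.loc s.castSucc = P.loc s.succ := hcon.elim id fun h => by
          simp only [hop, Op.supp, Finset.mem_singleton] at h
          rw [h.1, h.2]
        rw [hsame (by simp [hop, Op.IsTwoQubit]), ← heq]
        exact ih
      | feedforward k =>
        have heq : P.loc s.castSucc = P.loc s.succ := hcon.elim id fun h => by
          simp only [hop, Op.supp, Finset.mem_singleton] at h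
          rw [h.1, h.2]
        rw [hsame (by simp [hop, Op.IsTwoQubit]), ← heq]
        exact Or.inr ih
      | gate2 a b U Na Nb =>
        by_cases hb : P.loc s.castSucc ∈ (C.op s).supp ∧ P.loc s.succ ∈ (C.op s).supp
        · have hb' := hb
          simp only [hop, Op.supp, Finset.mem_insert, Finset.mem_singleton] at hb'
          refine Or.inl ⟨hb'.2, _, hb'.1, _, ?_, ih⟩
          rw [← Finset.card_insert_of_notMem (a := s) (by simp)]
          congr 1
          ext s'
          simp only [Finset.mem_filter, Finset.mem_univ, true_and, Fin.castSucc_lt_succ_iff,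
            Fin.castSucc_lt_castSucc_iff, Finset.mem_insert]
          refine ⟨fun h => h.1.eq_or_lt.imp id fun h' => ⟨h', h.2⟩, ?_⟩
          rintro (rfl | h)
          · exact ⟨le_rfl, hs, by simp [hop, Op.IsTwoQubit], hb⟩
          · exact ⟨h.1.le, h.2⟩
        -- The path does not move here, so if its position lay in the pair it would do so before and
        -- after, contrary to `hb`. It passes outside the gate, and the distance is kept.
        · have heq : P.loc s.castSucc = P.loc s.succ := hcon.resolve_right hb
          have hnot : P.loc s.succ ∉ (C.op s).supp := fun h => hb ⟨heq ▸ h, h⟩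
          simp only [hop, Op.supp, Finset.mem_insert, Finset.mem_singleton, not_or] at hnot
          rw [hsame fun h => hb h.2]
          exact Or.inr ⟨hnot.1, hnot.2, heq ▸ ih⟩

/-- Lengths are natural numbers: if every path to `j` were longer than `f`, the infimum would be at
least `f + 1`. -/
theorem exists_reach_le {f : ℕ} (hf : C.worstFeedforwardDistance = f) (j : Fin n) :
    ∃ l ≤ f, C.reach (Fin.last m) j l := by
  have hj : C.feedforwardDistance j ≤ f := hf ▸ le_iSup C.feedforwardDistance j
  obtain ⟨P, hP⟩ : ∃ P : C.FeedforwardPath j, P.length ≤ f := by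
    by_contra! hc
    have h1 : ((f + 1 : ℕ) : ℕ∞) ≤ C.feedforwardDistance j :=
      le_iInf fun P => Nat.cast_le.mpr (hc P)
    exact absurd (Nat.cast_le.mp (h1.trans hj)) (by omega)
  refine ⟨P.length, hP, ?_⟩
  have h := P.reach (Fin.last m) (Fin.castSucc_lt_last _)
  rw [P.ends] at h
  convert h using 1
  rw [FeedforwardPath.length]
  congr 1
  ext s
  simp only [Finset.mem_filter, Fin.castSucc_lt_last, true_and]

end Circuit

/-! ### Measurability of the channel -/

theorem BddMeas.conj {Ω ι : Type} [MeasurableSpace Ω] [Fintype ι] {A X : Ω → Matrix ι ι ℂ}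
    (hA : ∀ a b, BddMeas fun ω => A ω a b) (hX : ∀ a b, BddMeas fun ω => X ω a b) (a b : ι) :
    BddMeas fun ω => DynQC.conj (A ω) (X ω) a b := by
  simp only [DynQC.conj, Matrix.mul_apply, Matrix.conjTranspose_apply]
  exact BddMeas.sum _ fun c _ => (BddMeas.sum _ fun d _ => (hA _ _).mul (hX _ _)).mul (hA _ _).star

theorem bddMeas_tensor {Ω : Type} [MeasurableSpace Ω] {A : Ω → Fin n → Matrix (Fin 2) (Fin 2) ℂ}
    (hA : ∀ i a b, BddMeas fun ω => A ω i a b) (x y : Bits n) :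
    BddMeas fun ω => tensor (A ω) x y := by
  simp only [tensor, Matrix.of_apply]
  exact BddMeas.prod _ fun i _ => hA i _ _

theorem bddMeas_embed1 {Ω : Type} [MeasurableSpace Ω] (j : Fin n)
    {A : Ω → Matrix (Fin 2) (Fin 2) ℂ} (hA : ∀ a b, BddMeas fun ω => A ω a b) (x y : Bits n) :
    BddMeas fun ω => embed1 j (A ω) x y := by
  refine bddMeas_tensor (fun i a b => ?_) x y
  by_cases h : i = j
  · simpa [h] using hA a b
  · simpa [h] using BddMeas.const _

theorem bddMeas_gatesOn {Ω : Type} [MeasurableSpace Ω] (S : Finset (Fin n))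
    {V : Ω → Fin n → U2} (hV : ∀ i a b, BddMeas fun ω => (V ω i).1 a b) (x y : Bits n) :
    BddMeas fun ω => gatesOn S (V ω) x y := by
  refine bddMeas_tensor (fun i a b => ?_) x y
  by_cases h : i ∈ S
  · simpa [h] using hV i a b
  · simpa [h] using BddMeas.const _

theorem bddMeas_embed2 {Ω : Type} [MeasurableSpace Ω] (i j : Fin n)
    {A : Ω → Matrix (Fin 2 × Fin 2) (Fin 2 × Fin 2) ℂ} (hA : ∀ a b, BddMeas fun ω => A ω a b)
    (x y : Bits n) : BddMeas fun ω => embed2 i j (A ω) x y := by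
  simp only [embed2, Matrix.of_apply]
  split_ifs
  · exact hA _ _
  · exact BddMeas.const _

theorem bddMeas_applyAt {Ω : Type} [MeasurableSpace Ω] (N : QubitChannel) (j : Fin n)
    {X : Ω → Oper n} (hX : ∀ a b, BddMeas fun ω => X ω a b) (x y : Bits n) :
    BddMeas fun ω => N.applyAt j (X ω) x y := by
  simp only [QubitChannel.applyAt, Matrix.sum_apply]
  exact BddMeas.sum _ fun l _ =>
    BddMeas.conj (A := fun _ => embed1 j (N.kraus l)) (fun _ _ => BddMeas.const _) hX x y

theorem bddMeas_runInserted {o : Op n p} (φ ϕ : ℝ) (ho : o.GateMeasurable) (q q' : Fin n → Place n m)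
    {X : Sample n p m → Oper n} (hX : ∀ a b, BddMeas fun ω => X ω a b) (x y : Bits n) :
    BddMeas fun ω : Sample n p m =>
      o.runInserted φ ϕ ω.1 (fun j => ω.2 (q j)) (fun j => ω.2 (q' j)) (X ω) x y := by
  have hV : ∀ (q : Fin n → Place n m) i a b, BddMeas fun ω : Sample n p m => (ω.2 (q i)).1 a b :=
    fun q i a b => (bddMeas_entry a b).comp ((measurable_pi_apply (q i)).comp measurable_snd)
  have hgq : ∀ (S : Finset (Fin n)) (q : Fin n → Place n m) a b, BddMeas fun ω : Sample n p m =>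
      gatesOn S (fun j => ω.2 (q j)) a b := fun S q => bddMeas_gatesOn S (hV q)
  cases o with
  | gate1 j U =>
    have hU : ∀ a b, BddMeas fun ω : Sample n p m => (U ω.1).1 a b := fun a b =>
      bddMeas_of_norm_le_one ((ho a b).comp measurable_fst)
        fun ω => entry_norm_bound_of_unitary (U ω.1).2 a b
    simp only [Op.runInserted]
    exact BddMeas.conj (hgq _ q) (BddMeas.conj (bddMeas_embed1 j hU) hX) x y
  | feedforward j =>
    have hc : ∀ (M : Oper n) a b, BddMeas fun ω => DynQC.conj M (X ω) a b := fun M =>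
      BddMeas.conj (A := fun _ => M) (fun _ _ => BddMeas.const _) hX
    simp only [Op.runInserted]
    refine BddMeas.conj (X := fun ω => feedforwardAt φ ϕ j (X ω)) (hgq _ q) (fun a b => ?_) x y
    simp only [feedforwardAt, Matrix.add_apply]
    exact (hc _ a b).add (hc _ a b)
  | gate2 i j U Ni Nj =>
    have hU : ∀ a b, BddMeas fun ω : Sample n p m => (U ω.1).1 a b := fun a b =>
      bddMeas_of_norm_le_one ((ho a b).comp measurable_fst)
        fun ω => entry_norm_bound_of_unitary (U ω.1).2 a b
    simp only [Op.runInserted]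
    have h1 := BddMeas.conj (hgq {i, j} q) (BddMeas.conj (bddMeas_embed2 i j hU) hX)
    have h2 := bddMeas_applyAt Nj j (bddMeas_applyAt Ni i h1)
    exact BddMeas.conj (hgq _ q') h2 x y

theorem Circuit.bddMeas_stage (C : Circuit n p d m) (φ ϕ : ℝ) (hC : C.GatesMeasurable)
    (ρ : Oper n) (t : Fin (m + 1)) (x y : Bits n) :
    BddMeas fun ω : Sample n p m => C.stage φ ϕ ω ρ t x y := by
  induction t using Fin.induction generalizing x y with
  | zero =>
    have hV : ∀ x y, BddMeas fun ω : Sample n p m =>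
        gatesOn Finset.univ (fun j : Fin n => ω.2 (Sum.inl j)) x y :=
      bddMeas_gatesOn _ fun i a b => (bddMeas_entry a b).comp
        ((measurable_pi_apply (Sum.inl i)).comp measurable_snd)
    exact BddMeas.conj (X := fun _ => ρ) hV (fun _ _ => BddMeas.const _) x y
  | succ s ih =>
    simp only [C.stage_succ]
    exact bddMeas_runInserted φ ϕ (hC s) _ _ ih x y

/-- The second moment of the output state, for a locally scrambling circuit. -/
theorem Circuit.integral_output_mul (C : Circuit n p d m) {φ ϕ : ℝ} {D : Measure (Fin p → ℝ)}
    [IsProbabilityMeasure D] {E : Measure U2} [IsProbabilityMeasure E] (hC : C.GatesMeasurable)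
    (h : Measure.map (fun (θ : Fin p → ℝ) (x y z w : Bits n) =>
        C.channel φ ϕ θ (Matrix.single x y 1) z w) D =
      Measure.map (fun (ω : (Fin p → ℝ) × (Place n m → U2)) (x y z w : Bits n) =>
        C.channelInserted φ ϕ ω.1 ω.2 (Matrix.single x y 1) z w)
      (D.prod (Measure.pi fun _ => E))) (x x' y y' : Bits n) :
    ∫ θ, C.output φ ϕ θ x y * C.output φ ϕ θ x' y' ∂D =
      ∫ ω, C.stage φ ϕ ω (Matrix.single 0 0 1) (Fin.last m) x y *
        C.stage φ ϕ ω (Matrix.single 0 0 1) (Fin.last m) x' y'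
        ∂(D.prod (Measure.pi fun _ => E)) := by
  have hg : Measurable fun (ω : Sample n p m) (x y z w : Bits n) =>
      C.channelInserted φ ϕ ω.1 ω.2 (Matrix.single x y 1) z w := by
    simp only [measurable_pi_iff, C.channelInserted_eq_stage]
    exact fun x y z w => (C.bddMeas_stage φ ϕ hC _ _ z w).1
  have hf : Measurable fun (θ : Fin p → ℝ) (x y z w : Bits n) =>
      C.channel φ ϕ θ (Matrix.single x y 1) z w :=
    hg.comp (g := _) (f := fun θ : Fin p → ℝ => ((θ, fun _ => 1) : Sample n p m))
      measurable_prodMk_right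
  -- The input `|0ⁿ⟩⟨0ⁿ|` is the matrix unit with indices `0, 0`, so products of output entries are
  -- a function of the channel alone, and equality of laws gives equality of integrals.
  let Φ : (Bits n → Bits n → Bits n → Bits n → ℂ) → ℂ := fun K => K 0 0 x y * K 0 0 x' y'
  have hΦ : Measurable Φ := by fun_prop
  have h1 := integral_map hf.aemeasurable (f := Φ) (μ := D) hΦ.aestronglyMeasurable
  have h2 := integral_map hg.aemeasurable (f := Φ) (μ := D.prod (Measure.pi fun _ => E))
    hΦ.aestronglyMeasurable
  simp only [Φ, C.channelInserted_eq_stage] at h2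
  refine Eq.trans ?_ (h1.symm.trans ((congrArg (fun μ => ∫ K, Φ K ∂μ) h).trans ?_))
  · rfl
  · simpa only [Φ, C.channelInserted_eq_stage] using h2

/-! ### Pauli words -/

/-- The two-copy operator `site e` paired with two Pauli matrices. -/
theorem site_pauli (e : Fin 2) (a b : Fin 4) :
    ∑ c, ∑ d, ∑ c', ∑ d', site e (c, c') (d, d') * (pauli a d c * pauli b d' c') =
      if a = b then (if a = 0 then 1 else (bit e : ℂ)) else 0 := by
  fin_cases e
  · fin_cases a <;> fin_cases b <;>
      (simp [site_zero, pauli, bit, Matrix.one_apply, Prod.ext_iff]; try norm_num)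
  · fin_cases a <;> fin_cases b <;>
      simp [site_one, swapOp, pauli, bit, Matrix.one_apply] <;> norm_num

theorem trace_pauli_mul (a b : Fin 4) :
    (pauli a * pauli b).trace = if a = b then 2 else 0 := by
  fin_cases a <;> fin_cases b <;> simp [pauli, Matrix.trace] <;> norm_num

theorem trace_tensor (A : Fin n → Matrix (Fin 2) (Fin 2) ℂ) :
    (tensor A).trace = ∏ i, (A i).trace := by
  simp only [Matrix.trace, Matrix.diag_apply, tensor, Matrix.of_apply]
  exact (Fintype.prod_sum fun i c => A i c c).symm

theorem trace_pauliWord_mul (a b : Fin n → Fin 4) :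
    (pauliWord a * pauliWord b).trace = if a = b then 2 ^ n else 0 := by
  rw [pauliWord, pauliWord, tensor_mul, trace_tensor]
  simp only [trace_pauli_mul]
  split_ifs with h
  · simp [h]
  · obtain ⟨i, hi⟩ := Function.ne_iff.mp h
    exact Finset.prod_eq_zero (Finset.mem_univ i) (if_neg hi)

theorem trace_pauli_eq_zero {a : Fin 4} (ha : a ≠ 0) : ∑ c, pauli a c c = 0 := by
  fin_cases a <;> simp_all [pauli]

/-- The operator is the identity on qubit `i`, so the trace contains the factor `Tr (pauli (a i)) =
0`. -/
theorem trace_mul_pauliWord_eq_zero {A : Finset (Fin n)} {M : Oper n} (hM : ActsOn A M)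
    {a : Fin n → Fin 4} {i : Fin n} (hi : i ∉ A) (hai : a i ≠ 0) :
    (M * pauliWord a).trace = 0 := by
  obtain ⟨M', hM'⟩ := hM
  obtain ⟨N, hMu⟩ : ∃ N : Bits n → Bits n → ℂ, ∀ x y c d,
      M (Function.update x i c) (Function.update y i d) = if c = d then N x y else 0 := by
    refine ⟨fun x y => M (Function.update x i 0) (Function.update y i 0), fun x y c d => ?_⟩
    have hr : ∀ (x : Bits n) c, (fun l : A => Function.update x i c l) = fun l : A => x l := by
      intro x c
      funext l
      exact Function.update_of_ne (ne_of_mem_of_not_mem l.2 hi) _ _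
    simp only [hM', hr]
    by_cases hcd : c = d
    · rw [if_pos hcd]
      refine if_congr (forall₂_congr fun l hl => ?_) rfl rfl
      by_cases hli : l = i
      · subst hli; simp [hcd]
      · simp [hli]
    · rw [if_neg hcd, if_neg]
      exact fun h => hcd (by simpa using h i hi)
  have hP : ∀ (x y : Bits n) c d, pauliWord a (Function.update y i d) (Function.update x i c) =
      pauli (a i) d c * ∏ l ∈ Finset.univ.erase i, pauli (a l) (y l) (x l) := by
    intro x y c d
    rw [pauliWord, tensor, Matrix.of_apply, ← Finset.mul_prod_erase _ _ (Finset.mem_univ i)]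
    congr 1
    · simp
    · refine Finset.prod_congr rfl fun l hl => ?_
      rw [Function.update_of_ne (Finset.ne_of_mem_erase hl),
        Function.update_of_ne (Finset.ne_of_mem_erase hl)]
  -- One factor 2 for each of the two summation indices of the trace makes their labels at `i`
  -- explicit summation variables.
  have h2 : Fintype.card (Fin 2) • (Fintype.card (Fin 2) • (M * pauliWord a).trace) = 0 := by
    simp only [Matrix.trace, Matrix.diag_apply, Matrix.mul_apply]
    rw [Finset.smul_sum]
    simp_rw [Region.card_smul_sum (R := region1 i)]
    refine Finset.sum_eq_zero fun x _ => ?_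
    rw [Finset.sum_comm]
    refine Finset.sum_eq_zero fun y _ => ?_
    simp only [region1_set, hMu, hP]
    simp only [ite_mul, zero_mul, Finset.sum_ite_eq, Finset.mem_univ, if_true]
    rw [← Finset.mul_sum, ← Finset.sum_mul, trace_pauli_eq_zero hai, zero_mul, mul_zero]
  simpa using h2

/-- Pauli words are orthogonal for the trace form, so `c a` is read off from `Tr (H a)`. Each local
term contributes zero because the support of `a` is too large to fit into its set of qubits. -/
theorem coeff_eq_zero_of_isKLocal {k : ℕ} {H : Oper n} {c : (Fin n → Fin 4) → ℝ}
    (hH : H = ∑ a, (c a : ℂ) • pauliWord a) (hk : IsKLocal k H) {a : Fin n → Fin 4}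
    (ha : k < weight a) : c a = 0 := by
  obtain ⟨r, h, hh, hsum⟩ := hk
  have h1 : (H * pauliWord a).trace = 0 := by
    rw [hsum, Matrix.sum_mul, Matrix.trace_sum]
    refine Finset.sum_eq_zero fun l _ => ?_
    obtain ⟨-, A, hA, hact⟩ := hh l
    obtain ⟨i, hi, hiA⟩ := Finset.exists_mem_notMem_of_card_lt_card (lt_of_le_of_lt hA ha)
    exact trace_mul_pauliWord_eq_zero hact hiA (by simpa using hi)
  rw [hH, Matrix.sum_mul, Matrix.trace_sum] at h1
  simp only [Matrix.smul_mul, Matrix.trace_smul, trace_pauliWord_mul, smul_eq_mul, mul_ite,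
    mul_zero, Finset.sum_ite_eq', Finset.mem_univ, if_true] at h1
  have h2 : (2 : ℂ) ^ n ≠ 0 := pow_ne_zero _ two_ne_zero
  exact_mod_cast (mul_eq_zero.mp h1).resolve_right h2

/-- The support of a Pauli word. -/
def pauliSupp (a : Fin n → Fin 4) : Finset (Fin n) := Finset.univ.filter fun i => a i ≠ 0

/-- Both sides factor over the qubits; the sums over `y'`, `x'`, `y` and `x` are exchanged with the
product one at a time, leaving `site_pauli` at each qubit. -/
theorem sum_siteWord_pauli (v : Bits n) (a b : Fin n → Fin 4) :
    ∑ x, ∑ y, ∑ x', ∑ y', siteWord v x x' y y' * (pauliWord a y x * pauliWord b y' x') =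
      if a = b then ((∏ i ∈ pauliSupp a, bit (v i) : ℝ) : ℂ) else 0 := by
  let f : Fin n → Fin 2 → Fin 2 → Fin 2 → Fin 2 → ℂ := fun i c d c' d' =>
    site (v i) (c, c') (d, d') * (pauli (a i) d c * pauli (b i) d' c')
  have h : ∀ x y x' y' : Bits n, siteWord v x x' y y' * (pauliWord a y x * pauliWord b y' x') =
      ∏ i, f i (x i) (y i) (x' i) (y' i) := by
    intro x y x' y'
    simp only [siteWord, pauliWord, tensor, Matrix.of_apply, f, Finset.prod_mul_distrib]
  have h1 : ∀ x y x' : Bits n, ∑ y' : Bits n, ∏ i, f i (x i) (y i) (x' i) (y' i) =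
      ∏ i, ∑ d', f i (x i) (y i) (x' i) d' := fun x y x' =>
    (Fintype.prod_sum fun i d' => f i (x i) (y i) (x' i) d').symm
  have h2 : ∀ x y : Bits n, ∑ x' : Bits n, ∏ i, ∑ d', f i (x i) (y i) (x' i) d' =
      ∏ i, ∑ c', ∑ d', f i (x i) (y i) c' d' := fun x y =>
    (Fintype.prod_sum fun i c' => ∑ d', f i (x i) (y i) c' d').symm
  have h3 : ∀ x : Bits n, ∑ y : Bits n, ∏ i, ∑ c', ∑ d', f i (x i) (y i) c' d' =
      ∏ i, ∑ d, ∑ c', ∑ d', f i (x i) d c' d' := fun x =>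
    (Fintype.prod_sum fun i d => ∑ c', ∑ d', f i (x i) d c' d').symm
  have h4 : ∑ x : Bits n, ∏ i, ∑ d, ∑ c', ∑ d', f i (x i) d c' d' =
      ∏ i, ∑ c, ∑ d, ∑ c', ∑ d', f i c d c' d' :=
    (Fintype.prod_sum fun i c => ∑ d, ∑ c', ∑ d', f i c d c' d').symm
  simp only [h, h1, h2, h3, h4, f, site_pauli]
  split_ifs with hab
  · subst hab
    simp only [pauliSupp, Finset.prod_filter, if_true, ite_not, Complex.ofReal_prod]
    refine Finset.prod_congr rfl fun i _ => ?_
    split_ifs <;> simp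
  · obtain ⟨i, hi⟩ := Function.ne_iff.mp hab
    exact Finset.prod_eq_zero (Finset.mem_univ i) (if_neg hi)

/-! ### The variance of the loss -/

theorem sum4_sum_mul {κ ι : Type} [Fintype κ] [Fintype ι] (w : ι → ℂ)
    (g : ι → κ → κ → κ → κ → ℂ) (P : κ → κ → κ → κ → ℂ) :
    ∑ x, ∑ y, ∑ x', ∑ y', (∑ v, w v * g v x x' y y') * P x y x' y' =
      ∑ v, w v * ∑ x, ∑ y, ∑ x', ∑ y', g v x x' y y' * P x y x' y' := by
  have hc : ∀ f : κ → ι → ℂ, ∑ c, ∑ v, f c v = ∑ v, ∑ c, f c v := fun f => Finset.sum_comm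
  simp only [Finset.sum_mul, Finset.mul_sum, hc, mul_assoc]

/-- Second moments of Pauli expectation values. -/
theorem integral_trace_pauliWord {Ω : Type} [MeasurableSpace Ω] (μ : Measure Ω)
    [IsProbabilityMeasure μ] {F : Ω → Oper n} (hF : ∀ x y, BddMeas fun ω => F ω x y)
    {w : Bits n → ℝ}
    (hw : ∀ x x' y y', ∫ ω, F ω x y * F ω x' y' ∂μ = ∑ v, (w v : ℂ) * siteWord v x x' y y')
    (a b : Fin n → Fin 4) :
    ∫ ω, (F ω * pauliWord a).trace * (F ω * pauliWord b).trace ∂μ =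
      if a = b then ((tail w (pauliSupp a) : ℝ) : ℂ) else 0 := by
  have h : ∀ ω, (F ω * pauliWord a).trace * (F ω * pauliWord b).trace =
      ∑ x, ∑ y, ∑ x', ∑ y', F ω x y * F ω x' y' * (pauliWord a y x * pauliWord b y' x') := by
    intro ω
    simp only [Matrix.trace, Matrix.diag_apply, Matrix.mul_apply]
    exact sum_sum_mul_sum_sum _ _ _ _
  simp_rw [h]
  rw [integral_sum4_of_bddMeas _ fun x y x' y' =>
    ((hF _ _).mul (hF _ _)).mul (BddMeas.const _)]
  simp_rw [integral_mul_const, hw]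
  have h2 : ∑ x, ∑ y, ∑ x', ∑ y', (∑ v, (w v : ℂ) * siteWord v x x' y y') *
      (pauliWord a y x * pauliWord b y' x') = ∑ v, (w v : ℂ) *
        ∑ x, ∑ y, ∑ x', ∑ y', siteWord v x x' y y' * (pauliWord a y x * pauliWord b y' x') := by
    exact sum4_sum_mul _ _ fun x y x' y' => pauliWord a y x * pauliWord b y' x'
  rw [h2]
  simp only [sum_siteWord_pauli]
  split_ifs with hab
  · simp [tail]
  · simp

theorem pauliWord_zero : pauliWord (0 : Fin n → Fin 4) = 1 := by
  rw [← tensor_one]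
  rfl

/-- A random operator of trace one with site-word second moments has a loss whose variance is at
least the sum of its squared Pauli coefficients, weighted by the swap labels on their supports. -/
theorem sum_tail_le_variance {Ω : Type} [MeasurableSpace Ω] (μ : Measure Ω)
    [IsProbabilityMeasure μ] {F : Ω → Oper n} (hF : ∀ x y, BddMeas fun ω => F ω x y)
    (hF1 : ∀ ω, (F ω).trace = 1) {w : Bits n → ℝ}
    (hw : ∀ x x' y y', ∫ ω, F ω x y * F ω x' y' ∂μ = ∑ v, (w v : ℂ) * siteWord v x x' y y')
    {H : Oper n} {c : (Fin n → Fin 4) → ℝ} (hH : H = ∑ a, (c a : ℂ) • pauliWord a) :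
    ∑ a with a ≠ 0, c a ^ 2 * tail w (pauliSupp a) ≤
      variance (fun ω => (F ω * H).trace.re) μ := by
  have hzb : ∀ M : Oper n, BddMeas fun ω => (F ω * M).trace := fun M => by
    simp only [Matrix.trace, Matrix.diag_apply, Matrix.mul_apply]
    exact BddMeas.sum _ fun x _ => BddMeas.sum _ fun y _ => (hF _ _).mul (BddMeas.const _)
  have hz : ∀ ω, (F ω * H).trace = ∑ a, (c a : ℂ) * (F ω * pauliWord a).trace := fun ω => by
    rw [hH, Matrix.mul_sum, Matrix.trace_sum]
    simp only [Matrix.mul_smul, Matrix.trace_smul, smul_eq_mul]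
  have hmom := integral_trace_pauliWord μ hF hw
  have hz0 : ∀ ω, (F ω * pauliWord 0).trace = 1 := fun ω => by
    rw [pauliWord_zero, Matrix.mul_one, hF1]
  -- The total weight is 1: the identity word has expectation value 1, and its tail is over the
  -- empty set.
  have ht0 : tail w (pauliSupp (0 : Fin n → Fin 4)) = 1 := by
    have := hmom 0 0
    simp only [hz0, if_true] at this
    simpa using this.symm
  have hE1 : ∫ ω, (F ω * H).trace ∂μ = c 0 := by
    -- First moments are second moments with the identity word as the other factor.
    have h1 : ∀ a, ∫ ω, (F ω * pauliWord a).trace ∂μ = if a = 0 then 1 else 0 := fun a => by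
      have := hmom a 0
      simp only [hz0, mul_one] at this
      rw [this]
      split_ifs with h
      · rw [h, ht0, Complex.ofReal_one]
      · rfl
    simp_rw [hz]
    rw [integral_sum_of_bddMeas μ _ fun a => (BddMeas.const _).mul (hzb _)]
    simp_rw [integral_const_mul, h1]
    simp
  have hE2 : ∫ ω, (F ω * H).trace * (F ω * H).trace ∂μ =
      ((∑ a, c a ^ 2 * tail w (pauliSupp a) : ℝ) : ℂ) := by
    simp_rw [hz, Finset.sum_mul_sum]
    rw [integral_sum_of_bddMeas μ _ fun a => BddMeas.sum _ fun b _ =>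
      ((BddMeas.const _).mul (hzb _)).mul ((BddMeas.const _).mul (hzb _))]
    rw [Complex.ofReal_sum]
    refine Finset.sum_congr rfl fun a _ => ?_
    rw [integral_sum_of_bddMeas μ _ fun b =>
      ((BddMeas.const _).mul (hzb _)).mul ((BddMeas.const _).mul (hzb _))]
    have h1 : ∀ b, ∫ ω, (c a : ℂ) * (F ω * pauliWord a).trace *
        ((c b : ℂ) * (F ω * pauliWord b).trace) ∂μ = (c a : ℂ) * c b *
        if a = b then ((tail w (pauliSupp a) : ℝ) : ℂ) else 0 := fun b => by
      rw [← hmom, ← integral_const_mul]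
      refine integral_congr_ae (ae_of_all _ fun ω => ?_)
      ring
    simp_rw [h1]
    simp only [mul_ite, mul_zero, Finset.sum_ite_eq, Finset.mem_univ, if_true]
    push_cast
    ring
  have hb := hzb H
  have hre : Measurable fun ω => (F ω * H).trace.re := Complex.measurable_re.comp hb.1
  obtain ⟨B, hB⟩ := hb.2
  have hmem : MemLp (fun ω => (F ω * H).trace.re) 2 μ :=
    MemLp.of_bound hre.aestronglyMeasurable B
      (ae_of_all _ fun ω => (Complex.abs_re_le_norm _).trans (hB ω))
  have hm1 : ∫ ω, (F ω * H).trace.re ∂μ = c 0 := by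
    have := integral_re (hb.integrable μ)
    simp only [RCLike.re_to_complex] at this
    rw [this, hE1, Complex.ofReal_re]
  -- From `Re (z²) = (Re z)² - (Im z)² ≤ (Re z)²`. An inequality suffices here, so it is not
  -- necessary to show that `Tr (F H)` is real.
  have hm2 : ∑ a, c a ^ 2 * tail w (pauliSupp a) ≤ ∫ ω, (F ω * H).trace.re ^ 2 ∂μ := by
    have := integral_re ((hb.mul hb).integrable μ)
    simp only [RCLike.re_to_complex] at this
    rw [hE2, Complex.ofReal_re] at this
    rw [← this]
    refine integral_mono ((hb.mul hb).integrable μ).re hmem.integrable_sq fun ω => ?_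
    simp only [Complex.mul_re]
    nlinarith [sq_nonneg ((F ω * H).trace.im)]
  rw [variance_eq_sub hmem]
  have hsum : ∑ a, c a ^ 2 * tail w (pauliSupp a) =
      c 0 ^ 2 + ∑ a with a ≠ 0, c a ^ 2 * tail w (pauliSupp a) := by
    rw [← Finset.add_sum_erase _ _ (Finset.mem_univ 0), ht0, mul_one]
    congr 2
    ext a
    simp
  have h1 : (∫ ω, (F ω * H).trace.re ∂μ) = c 0 := hm1
  simp only [Pi.pow_apply]
  rw [h1]
  linarith

end DynQC

end

/-! ### The variance bound -/

theorem mainTheorem2 {n p d m : ℕ} (C : DynQC.Circuit n p d m) (D : Measure (Fin p → ℝ))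
    [IsProbabilityMeasure D] (φ ϕ α γ δ : ℝ) (f k : ℕ)
    (H : DynQC.Oper n) (c : (Fin n → Fin 4) → ℝ)
    (hH : H = ∑ a, (c a : ℂ) • DynQC.pauliWord a)
    (hk : DynQC.IsKLocal k H)
    (hmeas : C.GatesMeasurable)
    (hparam : C.SeparatelyParameterized D)
    (hscr : C.LocallyScrambling φ ϕ D)
    (hα0 : 0 ≤ α) (hα1 : α ≤ 1)
    (hgate : ∀ s, (C.op s).GateTransferCondition D α)
    (hf : C.worstFeedforwardDistance = f)
    (hδ0 : 0 ≤ δ) (hδγ : δ ≤ γ) (hγ : γ ≤ 1 / 2)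
    (hnoise : ∀ s, (C.op s).NoiseTransferCondition γ δ) :
    ∑ a with a ≠ 0, c a ^ 2 * (Real.sin φ ^ 2 / 3) ^ DynQC.weight a *
        (α / 5 * (1 - γ - δ) + δ) ^ (k * f)
      ≤ ProbabilityTheory.variance (C.loss φ ϕ H) D := by
  obtain ⟨owner, hdep, hD⟩ := hparam
  obtain ⟨E, hE, hmap⟩ := hscr
  have := hE.1
  obtain ⟨w, hw, htail, hmom⟩ := C.exists_hasMoments hD hE φ ϕ hmeas hdep hα0 hα1 hgate hδ0 hδγ
    hγ hnoise (Fin.last m)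
  -- Boundedness and the trace are inherited pointwise by setting all inserted gates to 1; only the
  -- second moments need the equality of laws.
  have hout : ∀ θ, C.output φ ϕ θ =
      C.stage φ ϕ (θ, fun _ => 1) (Matrix.single 0 0 1) (Fin.last m) := fun θ =>
    C.channelInserted_eq_stage φ ϕ (θ, fun _ => 1) _
  have hvar := DynQC.sum_tail_le_variance D (F := C.output φ ϕ) (w := w)
    (fun x y => by
      simp only [hout]
      exact (hmom.bdd x y).comp (u := fun θ : Fin p → ℝ => (θ, fun _ => 1)) measurable_prodMk_right)
    (fun θ => by rw [hout]; exact hmom.trace _)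
    (fun x x' y y' => by rw [C.integral_output_mul hmeas hmap]; exact hmom.moment x x' y y') hH
  refine le_trans (Finset.sum_le_sum fun a _ => ?_) hvar
  -- Locality enters only here: it bounds the number of paths, and hence the total distance on the
  -- support, by `k * f`.
  rcases lt_or_ge k (DynQC.weight a) with hka | hka
  · simp [DynQC.coeff_eq_zero_of_isKLocal hH hk hka]
  choose L hL hreach using C.exists_reach_le hf
  have hq0 : 0 ≤ α / 5 * (1 - γ - δ) + δ :=
    add_nonneg (mul_nonneg (by linarith) (by linarith)) hδ0
  have hq1 : α / 5 * (1 - γ - δ) + δ ≤ 1 := by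
    have : α / 5 * (1 - γ - δ) ≤ 1 * (1 - γ - δ) :=
      mul_le_mul_of_nonneg_right (by linarith) (by linarith)
    linarith
  rw [mul_assoc]
  refine mul_le_mul_of_nonneg_left ?_ (sq_nonneg _)
  refine le_trans ?_ (htail (DynQC.pauliSupp a) L fun i _ => hreach i)
  refine mul_le_mul_of_nonneg_left (pow_le_pow_of_le_one hq0 hq1 ?_) (by positivity)
  calc ∑ i ∈ DynQC.pauliSupp a, L i ≤ ∑ i ∈ DynQC.pauliSupp a, f :=
        Finset.sum_le_sum fun i _ => hL i
    _ = DynQC.weight a * f := by rw [Finset.sum_const, smul_eq_mul]; rfl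
    _ ≤ k * f := Nat.mul_le_mul_right f hka
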